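/- Let $0<\theta<\pi/2$, $\theta\neq\pi/4$, and $|\psi_\theta\rangle=\sin\theta|00\rangle+\cos\theta|11\rangle$. A local projective measurement on two qubits is given by projectors $A,B$ on the single qubits and a set of accepted outcome pairs: the two parties measure $\{A,\mathbb 1-A\}$ and $\{B,\mathbb 1-B\}$ and pass exactly when the pair of outcomes is in the set; its pass operator is the sum of the corresponding products of projectors. A strategy for $|\psi_\theta\rangle$ is a convex combination $\Omega$ of such pass operators with $\langle\psi_\theta|\Omega|\psi_\theta\rangle=1$. For $0<\epsilon\le 1$ it is called optimal at infidelity $\epsilon$ if it minimises, among all strategies, $\max\{\mathrm{tr}(\Omega\sigma):\ \sigma\text{ a density matrix},\ \langle\psi_\theta|\sigma|\psi_\theta\rangle\le 1-\epsilon\}$. Let $P^+_{ZZ}=\frac12(\mathbb 1+Z\otimes Z)$ be the projector onto the positive eigenspace of $Z\otimes Z$, and $$\Omega_{opt}=\alpha P^+_{ZZ}+\frac{1-\alpha}{3}\sum_{k=1}^3\left(\mathbb 1-|\phi_k\rangle\langle\phi_k|\right),\qquad \alpha=\frac{2-\sin2\theta}{4+\sin2\theta},\qquad q=\frac{2+\sin2\theta}{4+\sin2\theta},$$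 where $|\phi_k\rangle=(a|0\rangle+\omega_k b|1\rangle)\otimes(a|0\rangle+\omega'_k b|1\rangle)$ with $a=(1+\tan\theta)^{-1/2}$, $b=(1+\cot\theta)^{-1/2}$, $(\omega_1,\omega_2,\omega_3)=(e^{2\pi i/3},e^{4\pi i/3},1)$ and $(\omega'_1,\omega'_2,\omega'_3)=(e^{\pi i/3},e^{5\pi i/3},-1)$. Then: 1. $0<\alpha<1$, the tensor factors of the $|\phi_k\rangle$ are unit vectors, and $P^+_{ZZ}$ and $\mathbb 1-|\phi_k\rangle\langle\phi_k|$ ($k=1,2,3$) are pass operators of local projective measurements; $\Omega_{opt}$ is a strategy for $|\psi_\theta\rangle$. 2. The maximal probability $\max\{\langle\phi|\Omega_{opt}|\phi\rangle:\ \|\phi\|=1,\ \langle\psi_\theta|\phi\rangle=0\}$ with which $\Omega_{opt}$ accepts an orthogonal state equals $q$, and for every strategy this maximal probability is at least $q$. 3. For every $0<\epsilon\le1$, the maximum of $\mathrm{tr}(\Omega_{opt}\sigma)$ over density matrices $\sigma$ with $\langle\psi_\theta|\sigma|\psi_\theta\rangle\le1-\epsilon$ is $1-\epsilon(1-q)$,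 and a strategy is optimal at infidelity $\epsilon$ if and only if it is the operator $\Omega_{opt}$. 4. Say that $n$ measurements suffice for $(\epsilon,\delta)$ if there are strategies $\Omega_1,\dots,\Omega_n$ with $\prod_{i=1}^n\mathrm{tr}(\Omega_i\sigma_i)\le\delta$ for all density matrices $\sigma_1,\dots,\sigma_n$ with $\langle\psi_\theta|\sigma_i|\psi_\theta\rangle\le1-\epsilon$. For $0<\epsilon\le1$ and $0<\delta<1$, $n$ measurements suffice if and only if $n\ge\ln\delta^{-1}/\ln\left((1-\epsilon(1-q))^{-1}\right)$, and if and only if the choice $\Omega_1=\dots=\Omega_n=\Omega_{opt}$ achieves this. The least number $n_{opt}(\epsilon,\delta)$ of measurements that suffice satisfies, for every fixed $\delta\in(0,1)$, $$n_{opt}(\epsilon,\delta)\sim(2+\sin\theta\cos\theta)\,\epsilon^{-1}\ln\delta^{-1}\qquad(\epsilon\to0^+).$$ -/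

import Mathlib

open scoped Matrix Kronecker ComplexOrder Topology Asymptotics

noncomputable section

namespace TwoQubit

/-- Vectors of one qubit, `ℂ²`. -/
abbrev QVec := Fin 2 → ℂ

/-- Operators on one qubit. -/
abbrev QOp := Matrix (Fin 2) (Fin 2) ℂ

/-- Vectors of two qubits, `ℂ² ⊗ ℂ²` in the standard basis `|ij⟩`. -/
abbrev Vec := Fin 2 × Fin 2 → ℂ

/-- Operators on two qubits. -/
abbrev Op := Matrix (Fin 2 × Fin 2) (Fin 2 × Fin 2) ℂ

/-- The product vector `|u⟩ ⊗ |v⟩`. -/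
def tensor (u v : QVec) : Vec := fun i => u i.1 * v i.2

/-- The operator `|φ⟩⟨φ|`. -/
def ketbra (φ : Vec) : Op := Matrix.vecMulVec φ (star φ)

/-- The number `⟨φ|M|φ⟩`, as a real number (it is only used for Hermitian `M`). -/
def expect (φ : Vec) (M : Op) : ℝ := (star φ ⬝ᵥ (M *ᵥ φ)).re

/-- The target state `|ψ_θ⟩ = sin θ |00⟩ + cos θ |11⟩`. -/
def target (θ : ℝ) : Vec :=
  (Real.sin θ : ℂ) • tensor ![1, 0] ![1, 0] + (Real.cos θ : ℂ) • tensor ![0, 1] ![0, 1]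

/-- The two outcomes of the binary projective measurement `{A, 1 - A}`. -/
def outcome (A : QOp) (b : Bool) : QOp := if b then A else 1 - A

/-- `P` is the "pass" operator of a local projective measurement: each of the two parties performs
a projective measurement on its own qubit (`{A, 1 - A}` and `{B, 1 - B}`, trivial ones included),
and they accept exactly when the pair of their outcomes lies in a set `S`. -/
def IsLocalTest (P : Op) : Prop :=
  ∃ A B : QOp, IsStarProjection A ∧ IsStarProjection B ∧
    ∃ S : Finset (Bool × Bool), P = ∑ s ∈ S, outcome A s.1 ⊗ₖ outcome B s.2

/-- A strategy for `|ψ_θ⟩`: a convex combination of local projective measurements which accepts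
`|ψ_θ⟩` with certainty. -/
def IsStrategy (θ : ℝ) (Ω : Op) : Prop :=
  Ω ∈ convexHull ℝ {P : Op | IsLocalTest P} ∧ expect (target θ) Ω = 1

/-- Density matrices of two qubits. -/
def IsState (σ : Op) : Prop := σ.PosSemidef ∧ σ.trace = 1

/-- The probability `tr (Ω σ)` that one measurement passes on `σ`. -/
def passProb (Ω σ : Op) : ℝ := (Ω * σ).trace.re

/-- The states with fidelity at most `1 - ε` to the target. -/
def IsBad (θ ε : ℝ) (σ : Op) : Prop := IsState σ ∧ expect (target θ) σ ≤ 1 - ε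

/-- The passing probabilities of the states with fidelity at most `1 - ε` to the target. -/
def badPass (θ ε : ℝ) (Ω : Op) : Set ℝ := {p | ∃ σ, IsBad θ ε σ ∧ p = passProb Ω σ}

/-- The probabilities `⟨φ|Ω|φ⟩` for unit vectors `φ` orthogonal to the target. -/
def orthPass (θ : ℝ) (Ω : Op) : Set ℝ :=
  {p | ∃ φ : Vec, star φ ⬝ᵥ φ = 1 ∧ star (target θ) ⬝ᵥ φ = 0 ∧ p = expect φ Ω}

/-- `Ω` is an optimal strategy at infidelity `ε`: it minimises the largest passing probability of
the states with fidelity at most `1 - ε` among all strategies. -/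
def IsOptimal (θ ε : ℝ) (Ω : Op) : Prop :=
  IsStrategy θ Ω ∧ ∀ Ω', IsStrategy θ Ω' → sSup (badPass θ ε Ω) ≤ sSup (badPass θ ε Ω')

/-- The protocol that measures `Ω i` on the `i`-th of `n` copies, and accepts when all of these
pass, accepts with probability at most `δ` whenever all copies have fidelity at most `1 - ε`. -/
def Verifies (θ ε δ : ℝ) {n : ℕ} (Ω : Fin n → Op) : Prop :=
  ∀ σ : Fin n → Op, (∀ i, IsBad θ ε (σ i)) → ∏ i, passProb (Ω i) (σ i) ≤ δ

/-- `n` measurements suffice for infidelity `ε` and statistical power `1 - δ`. -/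
def Suffices (θ ε δ : ℝ) (n : ℕ) : Prop :=
  ∃ Ω : Fin n → Op, (∀ i, IsStrategy θ (Ω i)) ∧ Verifies θ ε δ Ω

/-- The least number of measurements for infidelity `ε` and statistical power `1 - δ`. -/
def numMeas (θ ε δ : ℝ) : ℕ := sInf {n | Suffices θ ε δ n}

/-- The Pauli operator `Z`. -/
def pauliZ : QOp := !![1, 0; 0, -1]

/-- The projector `(1 + ZZ) / 2` onto the positive eigenspace of `ZZ`. -/
def PZZ : Op := (1 / 2 : ℂ) • (1 + pauliZ ⊗ₖ pauliZ)

theorem pauliZZ_sq : (pauliZ ⊗ₖ pauliZ) * (pauliZ ⊗ₖ pauliZ) = (1 : Op) := by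
  rw [← Matrix.mul_kronecker_mul]
  have h : pauliZ * pauliZ = 1 := by
    ext i j; fin_cases i <;> fin_cases j <;> simp [pauliZ]
  rw [h, Matrix.one_kronecker_one]

/-- `PZZ` is an orthogonal projection. -/
theorem PZZ_isStarProjection : IsStarProjection PZZ := by
  constructor
  · unfold IsIdempotentElem PZZ
    rw [smul_mul_smul_comm, add_mul, mul_add, mul_add, pauliZZ_sq, one_mul, mul_one, one_mul]
    ext i j
    simp only [Matrix.smul_apply, Matrix.add_apply, smul_eq_mul]
    ring
  · ext i j
    fin_cases i <;> fin_cases j <;>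
      norm_num [PZZ, pauliZ, Matrix.star_apply]

/-- The range of `PZZ` is the eigenspace of `ZZ` for the eigenvalue `1`. -/
theorem PZZ_mulVec_eq_iff (w : Vec) : PZZ *ᵥ w = w ↔ (pauliZ ⊗ₖ pauliZ) *ᵥ w = w := by
  unfold PZZ
  rw [Matrix.smul_mulVec, Matrix.add_mulVec, Matrix.one_mulVec]
  simp only [funext_iff, Pi.smul_apply, Pi.add_apply, smul_eq_mul]
  refine forall_congr' fun i => ⟨fun h => ?_, fun h => ?_⟩
  · linear_combination 2 * h
  · linear_combination (1 / 2 : ℂ) * h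

/-- The states `|u_k⟩` of the first qubit. -/
def uVec (θ : ℝ) (k : Fin 3) : QVec :=
  ![((1 / √(1 + Real.tan θ) : ℝ) : ℂ),
    (![Complex.exp (2 * Real.pi * Complex.I / 3), Complex.exp (4 * Real.pi * Complex.I / 3), 1] :
      Fin 3 → ℂ) k * ((1 / √(1 + Real.cot θ) : ℝ) : ℂ)]

/-- The states `|v_k⟩` of the second qubit. -/
def vVec (θ : ℝ) (k : Fin 3) : QVec :=
  ![((1 / √(1 + Real.tan θ) : ℝ) : ℂ),
    (![Complex.exp (Real.pi * Complex.I / 3), Complex.exp (5 * Real.pi * Complex.I / 3), -1] :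
      Fin 3 → ℂ) k * ((1 / √(1 + Real.cot θ) : ℝ) : ℂ)]

/-- The measurement that accepts unless the outcome is `|φ_k⟩ = |u_k⟩ ⊗ |v_k⟩`. -/
def coTest (θ : ℝ) (k : Fin 3) : Op := 1 - ketbra (tensor (uVec θ k) (vVec θ k))

/-- The weight `α(θ)`. -/
def weight (θ : ℝ) : ℝ := (2 - Real.sin (2 * θ)) / (4 + Real.sin (2 * θ))

/-- The strategy `Ω_opt`. -/
def optStrategy (θ : ℝ) : Op :=
  weight θ • PZZ + ((1 - weight θ) / 3) • ∑ k : Fin 3, coTest θ k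

/-- The probability `q_opt` of accepting orthogonal states. -/
def qOpt (θ : ℝ) : ℝ := (2 + Real.sin (2 * θ)) / (4 + Real.sin (2 * θ))

end TwoQubit

end

namespace TwoQubit

/-! ### Linearity of `expect` and `passProb` -/

/-! The proof is a duality argument. The dual witness is `orthWitness θ`, a mixed state supported on
the orthogonal complement of the target, with weight `q` on `cotarget` and the remaining weight
split equally between `|01⟩` and `|10⟩`. Every local test that accepts the target with certainty
passes on it with probability at least `q` (`IsLocalTest.qOpt_le`), and this bound extends to
strategies by convexity.

For the bound on a local test, look at its rejected outcomes: they are product projections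
annihilating the target. Since the target has full Schmidt rank, a nonzero rejection consists of one
product of rank-one projections or of two diagonally opposite ones. For a single product,
orthogonality to the target limits its overlap with `cotarget` (`rejection_bound`). For an opposite
pair, `θ ≠ π/4` forces both measurements to be in the computational basis
(`passProb_rejected_pair_le`).

On the primal side, the phases and weights make `optStrategy θ` equal to `q • 1 + (1 - q) • ketbra
(target θ)` (`optStrategy_eq`), so it accepts every orthogonal state with probability exactly `q`.
If a strategy `Ω` does no worse, then `optStrategy θ - Ω` is positive semidefinite and vanishes
against a witness that has full rank on the complement, hence is zero (`IsStrategy.eq_optStrategy`).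

Mixing the target with the witness gives one bad state that is hardest for all strategies at once.
Using it on every copy reduces the count of measurements to powers of `1 - ε(1 - q)`. -/

theorem expect_add (φ : Vec) (M N : Op) : expect φ (M + N) = expect φ M + expect φ N := by
  simp [expect, Matrix.add_mulVec]

theorem expect_sub (φ : Vec) (M N : Op) : expect φ (M - N) = expect φ M - expect φ N := by
  simp [expect, Matrix.sub_mulVec]

theorem expect_smul (φ : Vec) (r : ℝ) (M : Op) : expect φ (r • M) = r * expect φ M := by
  simp [expect, Matrix.smul_mulVec]

theorem expect_one (φ : Vec) : expect φ 1 = (star φ ⬝ᵥ φ).re := by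
  simp [expect]

theorem passProb_add_left (M N σ : Op) : passProb (M + N) σ = passProb M σ + passProb N σ := by
  simp [passProb, add_mul]

theorem passProb_sub_left (M N σ : Op) : passProb (M - N) σ = passProb M σ - passProb N σ := by
  simp [passProb, sub_mul]

theorem passProb_smul_left (r : ℝ) (M σ : Op) : passProb (r • M) σ = r * passProb M σ := by
  simp [passProb]

theorem passProb_add_right (M σ τ : Op) : passProb M (σ + τ) = passProb M σ + passProb M τ := by
  simp [passProb, mul_add]

theorem passProb_smul_right (r : ℝ) (M σ : Op) : passProb M (r • σ) = r * passProb M σ := by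
  simp [passProb]

theorem passProb_sum_left {ι : Type*} (s : Finset ι) (M : ι → Op) (σ : Op) :
    passProb (∑ i ∈ s, M i) σ = ∑ i ∈ s, passProb (M i) σ := by
  simp [passProb, Finset.sum_mul, Matrix.trace_sum]

theorem passProb_one {σ : Op} (hσ : IsState σ) : passProb 1 σ = 1 := by
  simp [passProb, hσ.2]

theorem passProb_ketbra_right (M : Op) (φ : Vec) : passProb M (ketbra φ) = expect φ M := by
  rw [passProb, expect, ketbra, Matrix.mul_vecMulVec, Matrix.trace_vecMulVec, dotProduct_comm]

theorem passProb_ketbra_left (φ : Vec) (σ : Op) : passProb (ketbra φ) σ = expect φ σ := by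
  rw [← passProb_ketbra_right, passProb, passProb, Matrix.trace_mul_comm]

/-! ### Positivity -/

open scoped MatrixOrder in
theorem passProb_nonneg {M σ : Op} (hM : M.PosSemidef) (hσ : σ.PosSemidef) :
    0 ≤ passProb M σ := by
  -- With `M = B* B`, cyclicity turns the trace into that of the positive semidefinite `B σ B*`.
  obtain ⟨B, rfl⟩ := CStarAlgebra.nonneg_iff_eq_star_mul_self.mp hM.nonneg
  have h := (hσ.mul_mul_conjTranspose_same B).trace_nonneg
  rw [passProb, Matrix.mul_assoc, Matrix.trace_mul_comm]
  exact (Complex.nonneg_iff.mp h).1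

theorem ketbra_posSemidef (φ : Vec) : (ketbra φ).PosSemidef :=
  Matrix.posSemidef_vecMulVec_self_star φ

theorem expect_nonneg {M : Op} (hM : M.PosSemidef) (φ : Vec) : 0 ≤ expect φ M := by
  rw [← passProb_ketbra_right]
  exact passProb_nonneg hM (ketbra_posSemidef φ)

theorem mulVec_eq_zero_of_expect_eq_zero {M : Op} (hM : M.PosSemidef) {φ : Vec}
    (h : expect φ M = 0) : M *ᵥ φ = 0 := by
  rw [← hM.dotProduct_mulVec_zero_iff]
  have h0 := hM.dotProduct_mulVec_nonneg φ
  exact Complex.ext h (Complex.nonneg_iff.mp h0).2.symm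

theorem posSemidef_smul {M : Op} (hM : M.PosSemidef) {r : ℝ} (hr : 0 ≤ r) :
    (r • M).PosSemidef := hM.smul hr

theorem passProb_le_one {M σ : Op} (hM : (1 - M).PosSemidef) (hσ : IsState σ) :
    passProb M σ ≤ 1 := by
  have h := passProb_nonneg hM hσ.1
  rw [passProb_sub_left, passProb_one hσ] at h
  linarith

theorem ketbra_trace (φ : Vec) : (ketbra φ).trace = star φ ⬝ᵥ φ := by
  rw [ketbra, Matrix.trace_vecMulVec, dotProduct_comm]

theorem isState_ketbra {φ : Vec} (h : star φ ⬝ᵥ φ = 1) : IsState (ketbra φ) :=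
  ⟨ketbra_posSemidef φ, by rw [ketbra_trace, h]⟩

theorem expect_ketbra (φ χ : Vec) : expect φ (ketbra χ) = Complex.normSq (star χ ⬝ᵥ φ) := by
  have h : star φ ⬝ᵥ χ = star (star χ ⬝ᵥ φ) := by
    rw [Matrix.star_dotProduct]
  rw [expect, ketbra, Matrix.vecMulVec_mulVec, dotProduct_smul, h]
  simp [Complex.normSq_apply]

theorem IsState.convex {σ τ : Op} (hσ : IsState σ) (hτ : IsState τ) {a b : ℝ} (ha : 0 ≤ a)
    (hb : 0 ≤ b) (hab : a + b = 1) : IsState (a • σ + b • τ) := by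
  refine ⟨(posSemidef_smul hσ.1 ha).add (posSemidef_smul hτ.1 hb), ?_⟩
  rw [Matrix.trace_add, Matrix.trace_smul, Matrix.trace_smul, hσ.2, hτ.2, ← add_smul, hab, one_smul]

/-! ### The target, and a state orthogonal to it -/

theorem target_dotProduct_self (θ : ℝ) : star (target θ) ⬝ᵥ target θ = 1 := by
  have h : (Real.sin θ : ℂ) ^ 2 + (Real.cos θ : ℂ) ^ 2 = 1 := by
    exact_mod_cast Real.sin_sq_add_cos_sq θ
  simp only [target, tensor, dotProduct, Fintype.sum_prod_type, Fin.sum_univ_two, Pi.star_apply,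
    Pi.add_apply, Pi.smul_apply]
  simp only [Fin.isValue, Matrix.cons_val_zero, Matrix.cons_val_one, smul_eq_mul, mul_one, mul_zero,
    add_zero, zero_add, star_zero, RCLike.star_def, Complex.conj_ofReal]
  linear_combination h

/-- The vector `cos θ |00⟩ - sin θ |11⟩`. -/
noncomputable def cotarget (θ : ℝ) : Vec :=
  (Real.cos θ : ℂ) • tensor ![1, 0] ![1, 0] - (Real.sin θ : ℂ) • tensor ![0, 1] ![0, 1]

/-- A state supported on the orthogonal complement of the target which every strategy accepts
with probability at least `qOpt θ`. -/
noncomputable def orthWitness (θ : ℝ) : Op :=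
  qOpt θ • ketbra (cotarget θ) + ((1 - qOpt θ) / 2) •
    (ketbra (tensor ![1, 0] ![0, 1]) + ketbra (tensor ![0, 1] ![1, 0]))

theorem cotarget_dotProduct_self (θ : ℝ) : star (cotarget θ) ⬝ᵥ cotarget θ = 1 := by
  have h : (Real.sin θ : ℂ) ^ 2 + (Real.cos θ : ℂ) ^ 2 = 1 := by
    exact_mod_cast Real.sin_sq_add_cos_sq θ
  simp only [cotarget, tensor, dotProduct, Fintype.sum_prod_type, Fin.sum_univ_two, Pi.star_apply,
    Pi.sub_apply, Pi.smul_apply]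
  simp only [Fin.isValue, Matrix.cons_val_zero, Matrix.cons_val_one, smul_eq_mul, mul_one, mul_zero,
    add_zero, zero_add, sub_zero, zero_sub, star_zero, star_neg, RCLike.star_def,
    Complex.conj_ofReal]
  linear_combination h

theorem target_dotProduct_cotarget (θ : ℝ) : star (target θ) ⬝ᵥ cotarget θ = 0 := by
  simp only [target, cotarget, tensor, dotProduct, Fintype.sum_prod_type, Fin.sum_univ_two,
    Pi.star_apply, Pi.sub_apply, Pi.add_apply, Pi.smul_apply]
  simp only [Fin.isValue, Matrix.cons_val_zero, Matrix.cons_val_one, smul_eq_mul, mul_one, mul_zero,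
    add_zero, zero_add, sub_zero, zero_sub, star_zero, RCLike.star_def,
    Complex.conj_ofReal]
  ring

theorem tensor01_dotProduct_self :
    star (tensor ![1, 0] ![0, 1]) ⬝ᵥ tensor ![1, 0] ![0, 1] = 1 := by
  simp [tensor, dotProduct, Fintype.sum_prod_type]

theorem tensor10_dotProduct_self :
    star (tensor ![0, 1] ![1, 0]) ⬝ᵥ tensor ![0, 1] ![1, 0] = 1 := by
  simp [tensor, dotProduct, Fintype.sum_prod_type]

theorem target_dotProduct_tensor01 (θ : ℝ) :
    star (target θ) ⬝ᵥ tensor ![1, 0] ![0, 1] = 0 := by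
  simp [target, tensor, dotProduct, Fintype.sum_prod_type]

theorem target_dotProduct_tensor10 (θ : ℝ) :
    star (target θ) ⬝ᵥ tensor ![0, 1] ![1, 0] = 0 := by
  simp [target, tensor, dotProduct, Fintype.sum_prod_type]

theorem passProb_orthWitness (θ : ℝ) (M : Op) :
    passProb M (orthWitness θ) = qOpt θ * expect (cotarget θ) M + (1 - qOpt θ) / 2 *
      (expect (tensor ![1, 0] ![0, 1]) M + expect (tensor ![0, 1] ![1, 0]) M) := by
  simp only [orthWitness, passProb_add_right, passProb_smul_right, passProb_ketbra_right]

/-- The four vectors form an orthonormal basis. -/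
theorem expect_basis_sum (θ : ℝ) (M : Op) :
    expect (target θ) M + expect (cotarget θ) M + expect (tensor ![1, 0] ![0, 1]) M +
      expect (tensor ![0, 1] ![1, 0]) M = M.trace.re := by
  have h := Real.sin_sq_add_cos_sq θ
  simp [expect, target, cotarget, tensor, dotProduct, Matrix.mulVec, Fintype.sum_prod_type,
    Matrix.trace, -Complex.ofReal_sin, -Complex.ofReal_cos]
  linear_combination ((M (0,0) (0,0)).re + (M (1,1) (1,1)).re) * h

/-! ### Projections of one qubit -/

theorem posSemidef_of_isStarProjection {A : QOp} (hA : IsStarProjection A) : A.PosSemidef := by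
  have h := Matrix.posSemidef_conjTranspose_mul_self A
  rwa [← Matrix.star_eq_conjTranspose, hA.isSelfAdjoint.star_eq, hA.isIdempotentElem.eq] at h

theorem isStarProjection_outcome {A : QOp} (hA : IsStarProjection A) (b : Bool) :
    IsStarProjection (outcome A b) := by
  cases b
  · exact hA.one_sub
  · exact hA

theorem isStarProjection_entries {A : QOp} (hA : IsStarProjection A) :
    ∃ (p r : ℝ) (z : ℂ), A = !![(p : ℂ), z; star z, (r : ℂ)] ∧ p = p ^ 2 + Complex.normSq z ∧
      r = r ^ 2 + Complex.normSq z ∧ z * (p + r - 1) = 0 := by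
  have hs := hA.isSelfAdjoint.star_eq
  have hi := hA.isIdempotentElem.eq
  have s00 := congrFun (congrFun hs 0) 0
  have s11 := congrFun (congrFun hs 1) 1
  have s10 := congrFun (congrFun hs 1) 0
  rw [Matrix.star_apply] at s00 s11 s10
  obtain ⟨p, hp⟩ := Complex.conj_eq_iff_real.mp s00
  obtain ⟨r, hr⟩ := Complex.conj_eq_iff_real.mp s11
  have i00 := congrFun (congrFun hi 0) 0
  have i11 := congrFun (congrFun hi 1) 1
  have i01 := congrFun (congrFun hi 0) 1
  simp only [Matrix.mul_apply, Fin.sum_univ_two, hp, hr, ← s10] at i00 i11 i01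
  have hz : A 0 1 * star (A 0 1) = (Complex.normSq (A 0 1) : ℂ) := Complex.mul_conj _
  refine ⟨p, r, A 0 1, ?_, ?_, ?_, ?_⟩
  · ext i j
    fin_cases i <;> fin_cases j <;> simp [hp, hr, ← s10]
  · have : (p : ℂ) = p ^ 2 + Complex.normSq (A 0 1) := by linear_combination -i00 + hz
    exact_mod_cast this
  · have : (r : ℂ) = r ^ 2 + Complex.normSq (A 0 1) := by linear_combination -i11 + hz
    exact_mod_cast this
  · linear_combination i01

/-- A nontrivial projection of a qubit has rank one; only its unit trace is needed later. -/
theorem isStarProjection_trichotomy {A : QOp} (hA : IsStarProjection A) :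
    A = 0 ∨ A = 1 ∨ ∃ p : ℝ, A 0 0 = p ∧ A 1 1 = 1 - p := by
  obtain ⟨p, r, z, rfl, hp, hr, hz⟩ := isStarProjection_entries hA
  rcases mul_eq_zero.mp hz with rfl | h
  · have h0 : p * (p - 1) = 0 := by simp at hp; linear_combination -hp
    have h1 : r * (r - 1) = 0 := by simp at hr; linear_combination -hr
    rcases mul_eq_zero.mp h0 with h0 | h0 <;> rcases mul_eq_zero.mp h1 with h1 | h1
    · left; ext i j; fin_cases i <;> fin_cases j <;> simp [h0, h1]
    · right; right; exact ⟨p, by simp, by simp [h0, sub_eq_zero.mp h1]⟩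
    · right; right; exact ⟨p, by simp, by simp [h1, sub_eq_zero.mp h0]⟩
    · right; left
      ext i j; fin_cases i <;> fin_cases j <;> simp [sub_eq_zero.mp h0, sub_eq_zero.mp h1]
  · right; right
    exact ⟨p, by simp, by simp; linear_combination h⟩

theorem outcome_eq_zero_or_one {A : QOp} (h : A = 0 ∨ A = 1) (b : Bool) :
    outcome A b = 0 ∨ outcome A b = 1 := by
  rcases h with rfl | rfl <;> cases b <;> simp [outcome]

theorem eq_zero_or_one_of_outcome {A : QOp} {b : Bool} (h : outcome A b = 0) :
    A = 0 ∨ A = 1 := by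
  cases b
  · right; exact (sub_eq_zero.mp h).symm
  · left; simpa [outcome] using h

theorem outcome_add_outcome_not (A : QOp) (b : Bool) : outcome A b + outcome A (!b) = 1 := by
  cases b <;> simp [outcome]

theorem sum_outcome_kronecker (A B : QOp) :
    ∑ s : Bool × Bool, outcome A s.1 ⊗ₖ outcome B s.2 = 1 := by
  have hA := outcome_add_outcome_not A true
  have hB := outcome_add_outcome_not B true
  rw [Fintype.sum_prod_type]
  simp only [Fintype.sum_bool, Bool.not_true, ← Matrix.kronecker_add] at *
  rw [hB, ← Matrix.add_kronecker, hA, Matrix.one_kronecker_one]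

/-! ### Product effects that annihilate the target -/

theorem kronecker_mulVec_target (θ : ℝ) (A B : QOp) (i j : Fin 2) :
    ((A ⊗ₖ B) *ᵥ target θ) (i, j) =
      A i 0 * B j 0 * Real.sin θ + A i 1 * B j 1 * Real.cos θ := by
  simp [target, tensor, dotProduct, Matrix.mulVec, Fintype.sum_prod_type]

theorem kronecker_annihilates_iff {θ : ℝ} {A B : QOp} :
    (A ⊗ₖ B) *ᵥ target θ = 0 ↔
      ∀ i j, A i 0 * B j 0 * Real.sin θ + A i 1 * B j 1 * Real.cos θ = 0 := by
  simp only [← kronecker_mulVec_target, funext_iff, Prod.forall, Pi.zero_apply]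

/-- Both Schmidt coefficients are nonzero, so the target is a separating vector for operators on one
side. -/
theorem right_eq_zero_of_annihilates {θ : ℝ} (hs : Real.sin θ ≠ 0) (hc : Real.cos θ ≠ 0) {B : QOp}
    (h : ((1 : QOp) ⊗ₖ B) *ᵥ target θ = 0) : B = 0 := by
  rw [kronecker_annihilates_iff] at h
  have hs' : (Real.sin θ : ℂ) ≠ 0 := by exact_mod_cast hs
  have hc' : (Real.cos θ : ℂ) ≠ 0 := by exact_mod_cast hc
  ext i j
  have h0 := h 0 i
  have h1 := h 1 i
  fin_cases j <;> simp_all [-Complex.ofReal_sin, -Complex.ofReal_cos]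

theorem left_eq_zero_of_annihilates {θ : ℝ} (hs : Real.sin θ ≠ 0) (hc : Real.cos θ ≠ 0) {A : QOp}
    (h : (A ⊗ₖ (1 : QOp)) *ᵥ target θ = 0) : A = 0 := by
  rw [kronecker_annihilates_iff] at h
  have hs' : (Real.sin θ : ℂ) ≠ 0 := by exact_mod_cast hs
  have hc' : (Real.cos θ : ℂ) ≠ 0 := by exact_mod_cast hc
  ext i j
  have h0 := h i 0
  have h1 := h i 1
  fin_cases j <;> simp_all [-Complex.ofReal_sin, -Complex.ofReal_cos]

theorem kronecker_eq_zero_of_trivial {θ : ℝ} (hs : Real.sin θ ≠ 0) (hc : Real.cos θ ≠ 0)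
    {A B : QOp} (hAB : (A = 0 ∨ A = 1) ∨ (B = 0 ∨ B = 1)) (h : (A ⊗ₖ B) *ᵥ target θ = 0) :
    A ⊗ₖ B = 0 := by
  rcases hAB with (rfl | rfl) | (rfl | rfl)
  · simp
  · simp [right_eq_zero_of_annihilates hs hc h]
  · simp
  · simp [left_eq_zero_of_annihilates hs hc h]

/-! ### Rejection probabilities on the witness -/

theorem passProb_kronecker_orthWitness (θ : ℝ) (A B : QOp) :
    passProb (A ⊗ₖ B) (orthWitness θ) =
      (qOpt θ * (Real.cos θ ^ 2 * (A 0 0 * B 0 0) + Real.sin θ ^ 2 * (A 1 1 * B 1 1)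
        - Real.sin θ * Real.cos θ * (A 0 1 * B 0 1 + A 1 0 * B 1 0)) +
        (1 - qOpt θ) / 2 * (A 0 0 * B 1 1 + A 1 1 * B 0 0) : ℂ).re := by
  have h : ((1 - qOpt θ) / 2 : ℂ) = ((1 - qOpt θ) / 2 : ℝ) := by push_cast; ring
  rw [passProb_orthWitness, Complex.add_re, h, Complex.re_ofReal_mul, Complex.re_ofReal_mul]
  congr 2
  · rw [expect]
    congr 1
    simp [cotarget, tensor, dotProduct, Matrix.mulVec, Fintype.sum_prod_type,
      -Complex.ofReal_sin, -Complex.ofReal_cos]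
    ring
  · simp [expect, tensor, dotProduct, Matrix.mulVec, Fintype.sum_prod_type]

theorem qOpt_eq (θ : ℝ) :
    qOpt θ = (1 + Real.sin θ * Real.cos θ) / (2 + Real.sin θ * Real.cos θ) := by
  rw [qOpt, Real.sin_two_mul, ← mul_div_mul_left (1 + _) _ (two_ne_zero (α := ℝ))]
  congr 1 <;> ring

theorem one_sub_qOpt {θ : ℝ} (hs : 0 < Real.sin θ) (hc : 0 < Real.cos θ) :
    1 - qOpt θ = (2 + Real.sin θ * Real.cos θ)⁻¹ := by
  rw [qOpt_eq]
  field_simp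
  ring

theorem qOpt_pos {θ : ℝ} (hs : 0 < Real.sin θ) (hc : 0 < Real.cos θ) : 0 < qOpt θ := by
  rw [qOpt_eq]; positivity

theorem qOpt_lt_one {θ : ℝ} (hs : 0 < Real.sin θ) (hc : 0 < Real.cos θ) : qOpt θ < 1 := by
  have h := one_sub_qOpt hs hc
  have : 0 < (2 + Real.sin θ * Real.cos θ)⁻¹ := by positivity
  linarith

theorem passProb_zero (σ : Op) : passProb 0 σ = 0 := by simp [passProb]

theorem mem_Icc_of_apply_zero {A : QOp} (hA : IsStarProjection A) {p : ℝ} (hp : A 0 0 = p) :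
    0 ≤ p ∧ p ≤ 1 := by
  have h0 := (posSemidef_of_isStarProjection hA).diag_nonneg (i := 0)
  have h1 := (posSemidef_of_isStarProjection hA.one_sub).diag_nonneg (i := 0)
  rw [hp] at h0
  rw [Matrix.sub_apply, Matrix.one_apply_eq, hp, sub_nonneg] at h1
  exact ⟨by exact_mod_cast h0, by exact_mod_cast h1⟩

/-- Here `p`, `t` are the `00` entries of two rank-one projections `A`, `B`, and `X = Re (A₀₁ B₀₁)`;
`h0`, `h1` are the diagonal equations of annihilation. The number `K` below is the weight of `A ⊗ B`
on `cotarget`, and `1 - K` its weight on `|01⟩`, `|10⟩`. Because the vector is a product, the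
arithmetic-geometric mean inequality gives `2scK ≤ 1 - K`. The rejection probability is affine in
`K`, and `q` is the value for which it equals `1 - q` at the extreme `K = 1 / (1 + 2sc)`. -/
theorem rejection_bound {s c p t X q : ℝ} (hs : 0 < s) (hc : 0 < c) (hsc : s ^ 2 + c ^ 2 = 1)
    (hp : 0 ≤ p ∧ p ≤ 1) (ht : 0 ≤ t ∧ t ≤ 1) (hq : (1 - q) * (2 + s * c) = 1)
    (h0 : p * t * s + X * c = 0) (h1 : X * s + (1 - p) * (1 - t) * c = 0) :
    q * (c ^ 2 * (p * t) + s ^ 2 * ((1 - p) * (1 - t)) - 2 * (s * c) * X) +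
      (1 - q) / 2 * (p * (1 - t) + (1 - p) * t) ≤ 1 - q := by
  obtain ⟨K, hK⟩ : ∃ K, X = -(s * c) * K := ⟨-X / (s * c), by field_simp⟩
  subst hK
  have hu : p * t = c ^ 2 * K := by
    apply mul_right_cancel₀ hs.ne'
    linear_combination h0
  have hv : (1 - p) * (1 - t) = s ^ 2 * K := by
    apply mul_right_cancel₀ hc.ne'
    linear_combination h1
  have hm : p * (1 - t) + (1 - p) * t = 1 - K := by
    linear_combination -hu - hv - K * hsc
  have hm0 : 0 ≤ 1 - K := by
    rw [← hm]
    exact add_nonneg (mul_nonneg hp.1 (sub_nonneg.2 ht.2)) (mul_nonneg (sub_nonneg.2 hp.2) ht.1)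
  have hsq : (2 * (s * c) * K) ^ 2 ≤ (1 - K) ^ 2 := by
    have h4 : (2 * (s * c) * K) ^ 2 = 4 * ((p * t) * ((1 - p) * (1 - t))) := by
      rw [hu, hv]; ring
    rw [h4, ← hm]
    linarith [sq_nonneg (p * (1 - t) - (1 - p) * t)]
  have hle := le_trans (le_abs_self _) (abs_le_of_sq_le_sq hsq hm0)
  rw [hm, hu, hv]
  have hval : q * (c ^ 2 * (c ^ 2 * K) + s ^ 2 * (s ^ 2 * K) - 2 * (s * c) * (-(s * c) * K)) =
      q * K := by
    linear_combination q * K * (s ^ 2 + c ^ 2 + 1) * hsc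
  rw [hval]
  have hq0 : 0 < 1 - q := pos_of_mul_pos_left (hq ▸ one_pos) (by positivity)
  have h5 : (1 - q) * (1 - K - 2 * (s * c) * K) ≥ 0 := mul_nonneg hq0.le (by linarith)
  have h6 : 1 - q - (q * K + (1 - q) / 2 * (1 - K)) = (1 - q) * (1 - K - 2 * (s * c) * K) / 2 := by
    linear_combination K * hq
  linarith

theorem passProb_rejected_le {θ : ℝ} (hs : 0 < Real.sin θ) (hc : 0 < Real.cos θ) {A B : QOp}
    (hA : IsStarProjection A) (hB : IsStarProjection B) (h : (A ⊗ₖ B) *ᵥ target θ = 0) :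
    passProb (A ⊗ₖ B) (orthWitness θ) ≤ 1 - qOpt θ := by
  have hq := qOpt_lt_one hs hc
  by_cases hAB : (A = 0 ∨ A = 1) ∨ (B = 0 ∨ B = 1)
  · rw [kronecker_eq_zero_of_trivial hs.ne' hc.ne' hAB h, passProb_zero]
    linarith
  push Not at hAB
  obtain ⟨p, hp, hp'⟩ := ((isStarProjection_trichotomy hA).resolve_left hAB.1.1).resolve_left
    hAB.1.2
  obtain ⟨t, ht, ht'⟩ := ((isStarProjection_trichotomy hB).resolve_left hAB.2.1).resolve_left
    hAB.2.2
  have hp01 := mem_Icc_of_apply_zero hA hp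
  have ht01 := mem_Icc_of_apply_zero hB ht
  rw [kronecker_annihilates_iff] at h
  have e0 := congrArg Complex.re (h 0 0)
  have e1 := congrArg Complex.re (h 1 1)
  have hA10 : A 1 0 = star (A 0 1) := (congrFun (congrFun hA.isSelfAdjoint.star_eq 1) 0).symm
  have hB10 : B 1 0 = star (B 0 1) := (congrFun (congrFun hB.isSelfAdjoint.star_eq 1) 0).symm
  have hX : (A 1 0 * B 1 0).re = (A 0 1 * B 0 1).re := by
    rw [hA10, hB10]
    simp
  have hsc := Real.sin_sq_add_cos_sq θ
  have hqe : (1 - qOpt θ) * (2 + Real.sin θ * Real.cos θ) = 1 := by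
    rw [one_sub_qOpt hs hc, inv_mul_cancel₀ (by positivity)]
  have hval : passProb (A ⊗ₖ B) (orthWitness θ) =
      qOpt θ * (Real.cos θ ^ 2 * (p * t) + Real.sin θ ^ 2 * ((1 - p) * (1 - t))
        - 2 * (Real.sin θ * Real.cos θ) * (A 0 1 * B 0 1).re) +
        (1 - qOpt θ) / 2 * (p * (1 - t) + (1 - p) * t) := by
    have h2 : ((1 - qOpt θ) / 2 : ℂ) = ((1 - qOpt θ) / 2 : ℝ) := by push_cast; ring
    rw [passProb_kronecker_orthWitness, hp, hp', ht, ht', h2]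
    simp only [Complex.add_re, Complex.sub_re, Complex.re_ofReal_mul, ← Complex.ofReal_mul,
      ← Complex.ofReal_pow, hX, Complex.ofReal_re, ← Complex.ofReal_one, ← Complex.ofReal_sub]
    ring
  rw [hval]
  rw [hp, ht, ← Complex.ofReal_mul, Complex.add_re, Complex.re_mul_ofReal, Complex.re_mul_ofReal,
    Complex.ofReal_re, Complex.zero_re] at e0
  rw [hp', ht', ← Complex.ofReal_one, ← Complex.ofReal_sub, ← Complex.ofReal_sub,
    ← Complex.ofReal_mul, Complex.add_re, Complex.re_mul_ofReal, Complex.re_mul_ofReal, hX,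
    Complex.ofReal_re, Complex.zero_re] at e1
  exact rejection_bound hs hc hsc hp01 ht01 hqe e0 e1

/-- The off-diagonal equations for the two products differ by a linear system in `z` and `star w`
with determinant `cos² θ - sin² θ`. It is nonzero exactly because `θ ≠ π/4`, so both projections are
diagonal and `B = 1 - A`. In the nontrivial case the test is `PZZ`, which rejects the witness with
probability exactly `1 - q`. -/
theorem passProb_rejected_pair_le {θ : ℝ} (hs : 0 < Real.sin θ) (hc : 0 < Real.cos θ)
    (hne : Real.sin θ ≠ Real.cos θ) {A B : QOp}
    (hA : IsStarProjection A) (hB : IsStarProjection B) (h : (A ⊗ₖ B) *ᵥ target θ = 0)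
    (h' : ((1 - A) ⊗ₖ (1 - B)) *ᵥ target θ = 0) :
    passProb (A ⊗ₖ B) (orthWitness θ) + passProb ((1 - A) ⊗ₖ (1 - B)) (orthWitness θ)
      ≤ 1 - qOpt θ := by
  have hq := qOpt_lt_one hs hc
  obtain ⟨p, r, z, rfl, hp, hr, -⟩ := isStarProjection_entries hA
  obtain ⟨p', r', w, rfl, -, -, -⟩ := isStarProjection_entries hB
  rw [kronecker_annihilates_iff] at h h'
  have hs' : (Real.sin θ : ℂ) ≠ 0 := by exact_mod_cast hs.ne'
  have hc' : (Real.cos θ : ℂ) ≠ 0 := by exact_mod_cast hc.ne'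
  have e00 := h 0 0
  have e01 := h 0 1
  have e10 := h 1 0
  have e11 := h 1 1
  have f00 := h' 0 0
  have f01 := h' 0 1
  have f10 := h' 1 0
  have f11 := h' 1 1
  simp [-Complex.ofReal_sin, -Complex.ofReal_cos] at e00 e01 e10 e11 f00 f01 f10 f11
  have g01 : z * Real.cos θ + star w * Real.sin θ = 0 := by
    simp only [RCLike.star_def]; linear_combination e01 - f01
  have g10 : star z * Real.sin θ + w * Real.cos θ = 0 := by
    simp only [RCLike.star_def]; linear_combination e10 - f10
  have g10' : z * Real.sin θ + star w * Real.cos θ = 0 := by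
    simpa [-Complex.ofReal_sin, -Complex.ofReal_cos] using congrArg star g10
  have hz : z = 0 := by
    have hd : ((Real.cos θ ^ 2 - Real.sin θ ^ 2 : ℝ) : ℂ) ≠ 0 := by
      rw [Complex.ofReal_ne_zero, sub_ne_zero, Ne, sq_eq_sq₀ hc.le hs.le]
      exact hne.symm
    apply (mul_eq_zero.mp _).resolve_right hd
    push_cast [-Complex.ofReal_sin, -Complex.ofReal_cos]
    linear_combination Real.cos θ * g01 - Real.sin θ * g10'
  have hw : star w = 0 := by
    rw [hz, zero_mul, zero_add] at g10'
    exact (mul_eq_zero.mp g10').resolve_right hc'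
  have hp' : p' = 1 - p := by
    have : (p' : ℂ) = 1 - p := by
      apply mul_right_cancel₀ hs'
      rw [hz] at e00 f00
      linear_combination e00 - f00
    exact_mod_cast this
  have hr' : r' = 1 - r := by
    have : (r' : ℂ) = 1 - r := by
      apply mul_right_cancel₀ hc'
      rw [star_eq_zero] at hw
      rw [hw] at e11 f11
      linear_combination e11 - f11
    exact_mod_cast this
  rw [star_eq_zero] at hw
  subst hz hw hp' hr'
  simp only [map_zero, add_zero] at hp hr
  have h01 : ∀ x : ℝ, x = x ^ 2 → x = 0 ∨ x = 1 := fun x hx =>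
    (mul_eq_zero.mp (by linear_combination -hx : x * (x - 1) = 0)).imp_right sub_eq_zero.mp
  rw [passProb_kronecker_orthWitness, passProb_kronecker_orthWitness]
  rcases h01 p hp with h0 | h0 <;> rcases h01 r hr with h1 | h1 <;> simp [h0, h1] <;> linarith

/-! ### Local tests that accept the target -/

/-- A set of outcome pairs containing no full row or column is a partial matching. -/
theorem finset_bool_prod_cases : ∀ T : Finset (Bool × Bool),
    (∀ i, ¬ ((i, true) ∈ T ∧ (i, false) ∈ T)) → (∀ j, ¬ ((true, j) ∈ T ∧ (false, j) ∈ T)) →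
      T = ∅ ∨ (∃ s, T = {s}) ∨ ∃ j, T = {(true, j), (false, !j)} := by
  decide

theorem outcome_not (A : QOp) (b : Bool) : outcome A (!b) = 1 - outcome A b := by
  cases b <;> simp [outcome]

theorem one_sub_localTest (A B : QOp) (S : Finset (Bool × Bool)) :
    1 - ∑ s ∈ S, outcome A s.1 ⊗ₖ outcome B s.2 = ∑ s ∈ Sᶜ, outcome A s.1 ⊗ₖ outcome B s.2 := by
  rw [← sum_outcome_kronecker A B, ← Finset.sum_add_sum_compl S, add_sub_cancel_left]

theorem posSemidef_sum_outcome {A B : QOp} (hA : IsStarProjection A) (hB : IsStarProjection B)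
    (S : Finset (Bool × Bool)) : (∑ s ∈ S, outcome A s.1 ⊗ₖ outcome B s.2).PosSemidef :=
  Matrix.posSemidef_sum _ fun s _ =>
    (posSemidef_of_isStarProjection (isStarProjection_outcome hA s.1)).kronecker
      (posSemidef_of_isStarProjection (isStarProjection_outcome hB s.2))

theorem expect_sum {ι : Type*} (s : Finset ι) (M : ι → Op) (φ : Vec) :
    expect φ (∑ i ∈ s, M i) = ∑ i ∈ s, expect φ (M i) := by
  simp only [← passProb_ketbra_right, passProb_sum_left]

theorem passProb_sum_rejected_le {θ : ℝ} (hs : 0 < Real.sin θ) (hc : 0 < Real.cos θ)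
    (hne : Real.sin θ ≠ Real.cos θ) {A B : QOp} (hA : IsStarProjection A)
    (hB : IsStarProjection B) (T : Finset (Bool × Bool))
    (hT : ∀ s ∈ T, (outcome A s.1 ⊗ₖ outcome B s.2) *ᵥ target θ = 0) :
    passProb (∑ s ∈ T, outcome A s.1 ⊗ₖ outcome B s.2) (orthWitness θ) ≤ 1 - qOpt θ := by
  have hq := qOpt_lt_one hs hc
  by_cases hAB : (A = 0 ∨ A = 1) ∨ (B = 0 ∨ B = 1)
  · rw [Finset.sum_eq_zero, passProb_zero]
    · linarith
    · intro s hsT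
      exact kronecker_eq_zero_of_trivial hs.ne' hc.ne'
        (hAB.imp (fun h => outcome_eq_zero_or_one h _) fun h => outcome_eq_zero_or_one h _)
        (hT s hsT)
  rw [not_or] at hAB
  -- A fully rejected row sums to `outcome A i ⊗ 1`, which cannot annihilate the target unless `A`
  -- is trivial.
  have hrow : ∀ i, ¬ ((i, true) ∈ T ∧ (i, false) ∈ T) := by
    rintro i ⟨ht, hf⟩
    refine hAB.1 (eq_zero_or_one_of_outcome (b := i) (left_eq_zero_of_annihilates hs.ne' hc.ne' ?_))
    rw [← outcome_add_outcome_not B true, Matrix.kronecker_add, Matrix.add_mulVec, hT _ ht]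
    simpa using hT _ hf
  have hcol : ∀ j, ¬ ((true, j) ∈ T ∧ (false, j) ∈ T) := by
    rintro j ⟨ht, hf⟩
    refine hAB.2 (eq_zero_or_one_of_outcome (b := j)
      (right_eq_zero_of_annihilates hs.ne' hc.ne' ?_))
    rw [← outcome_add_outcome_not A true, Matrix.add_kronecker, Matrix.add_mulVec, hT _ ht]
    simpa using hT _ hf
  rcases finset_bool_prod_cases T hrow hcol with rfl | ⟨s, rfl⟩ | ⟨j, rfl⟩
  · rw [Finset.sum_empty, passProb_zero]
    linarith
  · rw [Finset.sum_singleton]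
    exact passProb_rejected_le hs hc (isStarProjection_outcome hA _)
      (isStarProjection_outcome hB _) (hT s (Finset.mem_singleton_self s))
  · have h1 := hT (true, j) (by simp)
    have h2 := hT (false, !j) (by simp)
    rw [Finset.sum_pair (by simp), passProb_add_left]
    simp only [outcome_not] at h2 ⊢
    exact passProb_rejected_pair_le hs hc hne hA (isStarProjection_outcome hB j) h1 h2

theorem IsLocalTest.posSemidef {P : Op} (hP : IsLocalTest P) : P.PosSemidef := by
  obtain ⟨A, B, hA, hB, S, rfl⟩ := hP
  exact posSemidef_sum_outcome hA hB S

theorem IsLocalTest.one_sub_posSemidef {P : Op} (hP : IsLocalTest P) : (1 - P).PosSemidef := by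
  obtain ⟨A, B, hA, hB, S, rfl⟩ := hP
  rw [one_sub_localTest]
  exact posSemidef_sum_outcome hA hB Sᶜ

theorem expect_target_one (θ : ℝ) : expect (target θ) 1 = 1 := by
  rw [expect_one, target_dotProduct_self, Complex.one_re]

theorem isState_orthWitness {θ : ℝ} (hs : 0 < Real.sin θ) (hc : 0 < Real.cos θ) :
    IsState (orthWitness θ) := by
  have h0 := qOpt_pos hs hc
  have h1 := qOpt_lt_one hs hc
  have h := ((isState_ketbra tensor01_dotProduct_self).convex
    (isState_ketbra tensor10_dotProduct_self) (a := 1 / 2) (b := 1 / 2) (by norm_num) (by norm_num)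
    (by norm_num))
  convert (isState_ketbra (cotarget_dotProduct_self θ)).convex h (a := qOpt θ) (b := 1 - qOpt θ)
    h0.le (by linarith) (by ring) using 1
  rw [orthWitness, ← smul_add, smul_smul]
  ring_nf

theorem IsLocalTest.qOpt_le {θ : ℝ} (hs : 0 < Real.sin θ) (hc : 0 < Real.cos θ)
    (hne : Real.sin θ ≠ Real.cos θ) {P : Op} (hP : IsLocalTest P)
    (hψ : expect (target θ) P = 1) : qOpt θ ≤ passProb P (orthWitness θ) := by
  obtain ⟨A, B, hA, hB, S, rfl⟩ := hP
  have h0 : expect (target θ) (1 - ∑ s ∈ S, outcome A s.1 ⊗ₖ outcome B s.2) = 0 := by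
    rw [expect_sub, hψ, expect_target_one, sub_self]
  have hps : ∀ s : Bool × Bool, (outcome A s.1 ⊗ₖ outcome B s.2).PosSemidef := fun s =>
    (posSemidef_of_isStarProjection (isStarProjection_outcome hA s.1)).kronecker
      (posSemidef_of_isStarProjection (isStarProjection_outcome hB s.2))
  rw [one_sub_localTest, expect_sum,
    Finset.sum_eq_zero_iff_of_nonneg fun s _ => expect_nonneg (hps s) _] at h0
  have h := passProb_sum_rejected_le hs hc hne hA hB Sᶜ
    fun s hsS => mulVec_eq_zero_of_expect_eq_zero (hps s) (h0 s hsS)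
  rw [← one_sub_localTest, passProb_sub_left, passProb_one (isState_orthWitness hs hc)] at h
  linarith

/-! ### Strategies -/

/-- The bound is stated as an implication so that it defines a convex set: expectations are at most
one, so a mixture with positive weights accepts the target surely only if both components do. -/
theorem mem_convexHull_localTest {θ : ℝ} (hs : 0 < Real.sin θ) (hc : 0 < Real.cos θ)
    (hne : Real.sin θ ≠ Real.cos θ) {Ω : Op} (hΩ : Ω ∈ convexHull ℝ {P : Op | IsLocalTest P}) :
    Ω.PosSemidef ∧ (1 - Ω).PosSemidef ∧
      (expect (target θ) Ω = 1 → qOpt θ ≤ passProb Ω (orthWitness θ)) := by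
  have hle : ∀ M : Op, (1 - M).PosSemidef → expect (target θ) M ≤ 1 := fun M hM => by
    have := expect_nonneg hM (target θ)
    rw [expect_sub, expect_target_one] at this
    linarith
  refine convexHull_min (t := {Ω | Ω.PosSemidef ∧ (1 - Ω).PosSemidef ∧
    (expect (target θ) Ω = 1 → qOpt θ ≤ passProb Ω (orthWitness θ))}) ?_ ?_ hΩ
  · exact fun P hP => ⟨hP.posSemidef, hP.one_sub_posSemidef, hP.qOpt_le hs hc hne⟩
  · rw [convex_iff_forall_pos]
    rintro M ⟨hM, hM', hMq⟩ N ⟨hN, hN', hNq⟩ a b ha hb hab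
    refine ⟨(posSemidef_smul hM ha.le).add (posSemidef_smul hN hb.le), ?_, fun h => ?_⟩
    · convert (posSemidef_smul hM' ha.le).add (posSemidef_smul hN' hb.le) using 1
      rw [smul_sub, smul_sub, sub_add_sub_comm, ← add_smul, hab, one_smul]
    · rw [expect_add, expect_smul, expect_smul] at h
      have h1 := hle M hM'
      have h2 := hle N hN'
      have e1 : expect (target θ) M = 1 := by nlinarith
      have e2 : expect (target θ) N = 1 := by nlinarith
      rw [passProb_add_left, passProb_smul_left, passProb_smul_left]
      calc qOpt θ = a * qOpt θ + b * qOpt θ := by rw [← add_mul, hab, one_mul]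
        _ ≤ _ := add_le_add (mul_le_mul_of_nonneg_left (hMq e1) ha.le)
          (mul_le_mul_of_nonneg_left (hNq e2) hb.le)

/-! ### The measurement settings of the optimal strategy -/

/-- All phases are polynomials in `ζ = exp (iπ/3)`; these relations make the later identities purely
algebraic. -/
theorem exists_sixthRoot : ∃ ζ : ℂ, ζ ^ 2 = ζ - 1 ∧ (starRingEnd ℂ) ζ = 1 - ζ ∧
    Complex.exp (Real.pi * Complex.I / 3) = ζ ∧ Complex.exp (2 * Real.pi * Complex.I / 3) = ζ - 1 ∧
    Complex.exp (4 * Real.pi * Complex.I / 3) = -ζ ∧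
    Complex.exp (5 * Real.pi * Complex.I / 3) = 1 - ζ := by
  have hζ : Complex.exp (Real.pi * Complex.I / 3) = 1 / 2 + (√3 / 2 : ℝ) * Complex.I := by
    have : (Real.pi * Complex.I / 3 : ℂ) = ((Real.pi / 3 : ℝ) : ℂ) * Complex.I := by
      push_cast; ring
    rw [this, Complex.exp_mul_I, ← Complex.ofReal_cos, ← Complex.ofReal_sin, Real.cos_pi_div_three,
      Real.sin_pi_div_three]
    norm_num
  have h3 : ((√3 / 2 : ℝ) : ℂ) ^ 2 = 3 / 4 := by
    rw [← Complex.ofReal_pow, div_pow, Real.sq_sqrt (by norm_num)]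
    norm_num
  have hsq : Complex.exp (Real.pi * Complex.I / 3) ^ 2 =
      Complex.exp (Real.pi * Complex.I / 3) - 1 := by
    rw [hζ]
    linear_combination h3 * Complex.I ^ 2 + 3 / 4 * Complex.I_sq
  have hpow : ∀ n : ℕ, Complex.exp (n * Real.pi * Complex.I / 3) =
      Complex.exp (Real.pi * Complex.I / 3) ^ n := fun n => by
    rw [← Complex.exp_nat_mul]; ring_nf
  refine ⟨_, hsq, ?_, rfl, ?_, ?_, ?_⟩
  · rw [hζ]
    simp only [map_add, map_mul, map_div₀, map_one, map_ofNat, Complex.conj_I, Complex.conj_ofReal]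
    ring
  · rw [← hsq, ← hpow 2]; norm_num
  · trans Complex.exp (Real.pi * Complex.I / 3) ^ 4
    · rw [← hpow 4]; norm_num
    · generalize Complex.exp (Real.pi * Complex.I / 3) = ζ at hsq
      linear_combination (ζ ^ 2 + ζ) * hsq
  · trans Complex.exp (Real.pi * Complex.I / 3) ^ 5
    · rw [← hpow 5]; norm_num
    · generalize Complex.exp (Real.pi * Complex.I / 3) = ζ at hsq
      linear_combination (ζ ^ 3 + ζ ^ 2 - 1) * hsq

theorem isStarProjection_vecMulVec {u : QVec} (hu : star u ⬝ᵥ u = 1) :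
    IsStarProjection (Matrix.vecMulVec u (star u)) := by
  constructor
  · rw [IsIdempotentElem, Matrix.vecMulVec_mul_vecMulVec, hu, one_smul]
  · rw [IsSelfAdjoint, Matrix.star_eq_conjTranspose, Matrix.conjTranspose_vecMulVec, star_star]

theorem ketbra_tensor (u v : QVec) :
    ketbra (tensor u v) = Matrix.vecMulVec u (star u) ⊗ₖ Matrix.vecMulVec v (star v) := by
  ext i j
  simp [ketbra, tensor, Matrix.vecMulVec_apply]
  ring

theorem isLocalTest_one_sub_ketbra {u v : QVec} (hu : star u ⬝ᵥ u = 1) (hv : star v ⬝ᵥ v = 1) :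
    IsLocalTest (1 - ketbra (tensor u v)) := by
  refine ⟨_, _, isStarProjection_vecMulVec hu, isStarProjection_vecMulVec hv, {(true, true)}ᶜ, ?_⟩
  rw [← one_sub_localTest, Finset.sum_singleton, ketbra_tensor]
  simp [outcome]

theorem PZZ_eq : PZZ = ketbra (tensor ![1, 0] ![1, 0]) + ketbra (tensor ![0, 1] ![0, 1]) := by
  ext ⟨i, j⟩ ⟨k, l⟩
  fin_cases i <;> fin_cases j <;> fin_cases k <;> fin_cases l <;>
    norm_num [PZZ, pauliZ, ketbra, tensor, Matrix.vecMulVec_apply]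

theorem isLocalTest_PZZ : IsLocalTest PZZ := by
  have h : IsStarProjection (Matrix.vecMulVec ![1, 0] (star ![1, 0]) : QOp) :=
    isStarProjection_vecMulVec (by simp [dotProduct])
  have hc : (1 - Matrix.vecMulVec ![1, 0] (star ![1, 0]) : QOp) =
      Matrix.vecMulVec ![0, 1] (star ![0, 1]) := by
    ext i j
    rw [Matrix.sub_apply, Matrix.vecMulVec_apply, Matrix.vecMulVec_apply]
    fin_cases i <;> fin_cases j <;> simp
  refine ⟨_, _, h, h, {(true, true), (false, false)}, ?_⟩
  rw [Finset.sum_pair (by simp), PZZ_eq, ketbra_tensor, ketbra_tensor]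
  simp only [outcome, if_true, Bool.false_eq_true, if_false, hc]

theorem amplitude_sq {θ : ℝ} (hs : 0 < Real.sin θ) (hc : 0 < Real.cos θ) :
    (1 / √(1 + Real.tan θ)) ^ 2 = Real.cos θ / (Real.sin θ + Real.cos θ) ∧
      (1 / √(1 + Real.cot θ)) ^ 2 = Real.sin θ / (Real.sin θ + Real.cos θ) := by
  have ht : 0 < 1 + Real.tan θ := by rw [Real.tan_eq_sin_div_cos]; positivity
  have hct : 0 < 1 + Real.cot θ := by rw [Real.cot_eq_cos_div_sin]; positivity
  rw [div_pow, div_pow, Real.sq_sqrt ht.le, Real.sq_sqrt hct.le, Real.tan_eq_sin_div_cos,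
    Real.cot_eq_cos_div_sin]
  constructor
  · field_simp
    ring
  · field_simp

theorem qubit_dotProduct_self {a b : ℝ} {z : ℂ} (hab : a ^ 2 + b ^ 2 = 1)
    (hz : (starRingEnd ℂ) z * z = 1) :
    star (![(a : ℂ), z * (b : ℂ)] : QVec) ⬝ᵥ ![(a : ℂ), z * (b : ℂ)] = 1 := by
  have hab' : (a : ℂ) ^ 2 + (b : ℂ) ^ 2 = 1 := by exact_mod_cast hab
  simp [dotProduct, Fin.sum_univ_two]
  linear_combination hab' + (b : ℂ) ^ 2 * hz

theorem uVec_vVec_unit {θ : ℝ} (hs : 0 < Real.sin θ) (hc : 0 < Real.cos θ) (k : Fin 3) :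
    star (uVec θ k) ⬝ᵥ uVec θ k = 1 ∧ star (vVec θ k) ⬝ᵥ vVec θ k = 1 := by
  have hab : (1 / √(1 + Real.tan θ)) ^ 2 + (1 / √(1 + Real.cot θ)) ^ 2 = 1 := by
    rw [(amplitude_sq hs hc).1, (amplitude_sq hs hc).2]
    field_simp
    ring
  obtain ⟨ζ, hζ, hconj, h1, h2, h4, h5⟩ := exists_sixthRoot
  constructor <;> refine qubit_dotProduct_self hab ?_ <;> fin_cases k <;>
    simp [h1, h2, h4, h5, hconj] <;> linear_combination -hζ

/-- The two phases of each setting multiply to `-1`, so the part on `|00⟩`, `|11⟩` is common to all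
three. All other coherences carry phases that sum to zero over the three settings. -/
theorem sum_ketbra_tensor {a b : ℝ} {ζ : ℂ} (hζ : ζ ^ 2 = ζ - 1)
    (hconj : (starRingEnd ℂ) ζ = 1 - ζ) :
    ∑ k : Fin 3, ketbra (tensor ![(a : ℂ), (![ζ - 1, -ζ, 1] : Fin 3 → ℂ) k * (b : ℂ)]
        ![(a : ℂ), (![ζ, 1 - ζ, -1] : Fin 3 → ℂ) k * (b : ℂ)]) =
      (3 : ℝ) • (ketbra (((a ^ 2 : ℝ) : ℂ) • tensor ![1, 0] ![1, 0] -
        ((b ^ 2 : ℝ) : ℂ) • tensor ![0, 1] ![0, 1]) + (a ^ 2 * b ^ 2) •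
        (ketbra (tensor ![1, 0] ![0, 1]) + ketbra (tensor ![0, 1] ![1, 0]))) := by
  ext ⟨i, j⟩ ⟨k, l⟩
  fin_cases i <;> fin_cases j <;> fin_cases k <;> fin_cases l <;>
    simp [Fin.sum_univ_three, ketbra, tensor, Matrix.vecMulVec_apply, hconj] <;> grind

theorem cotarget_scaled {θ : ℝ} {r : ℝ} :
    ketbra (((r * Real.cos θ : ℝ) : ℂ) • tensor ![1, 0] ![1, 0] -
        ((r * Real.sin θ : ℝ) : ℂ) • tensor ![0, 1] ![0, 1]) = r ^ 2 • ketbra (cotarget θ) := by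
  ext i j
  simp [ketbra, cotarget, Matrix.vecMulVec_apply]
  ring

theorem target_cotarget_sum (θ : ℝ) : ketbra (target θ) + ketbra (cotarget θ) = PZZ := by
  have h : (Real.sin θ : ℂ) ^ 2 + (Real.cos θ : ℂ) ^ 2 = 1 := by
    exact_mod_cast Real.sin_sq_add_cos_sq θ
  rw [PZZ_eq]
  ext ⟨i, j⟩ ⟨k, l⟩
  fin_cases i <;> fin_cases j <;> fin_cases k <;> fin_cases l <;>
    simp [ketbra, target, cotarget, tensor, Matrix.vecMulVec_apply, -Complex.ofReal_sin,
      -Complex.ofReal_cos] <;> first | linear_combination h | ring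

theorem one_sub_PZZ : 1 - PZZ =
    ketbra (tensor ![1, 0] ![0, 1]) + ketbra (tensor ![0, 1] ![1, 0]) := by
  ext ⟨i, j⟩ ⟨k, l⟩
  fin_cases i <;> fin_cases j <;> fin_cases k <;> fin_cases l <;>
    norm_num [PZZ, pauliZ, ketbra, tensor, Matrix.vecMulVec_apply]

theorem weight_eq (θ : ℝ) :
    weight θ = (1 - Real.sin θ * Real.cos θ) / (2 + Real.sin θ * Real.cos θ) := by
  rw [weight, Real.sin_two_mul, ← mul_div_mul_left (1 - _) _ (two_ne_zero (α := ℝ))]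
  congr 1 <;> ring

theorem sum_coTest {θ : ℝ} (hs : 0 < Real.sin θ) (hc : 0 < Real.cos θ) :
    ∑ k, coTest θ k = (3 : ℝ) • (1 - ((Real.sin θ + Real.cos θ) ^ 2)⁻¹ •
      (ketbra (cotarget θ) + (Real.sin θ * Real.cos θ) • (1 - PZZ))) := by
  obtain ⟨ζ, hζ, hconj, h1, h2, h4, h5⟩ := exists_sixthRoot
  have h := sum_ketbra_tensor (a := 1 / √(1 + Real.tan θ)) (b := 1 / √(1 + Real.cot θ)) hζ hconj
  obtain ⟨ha, hb⟩ := amplitude_sq hs hc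
  simp only [coTest, uVec, vVec, h1, h2, h4, h5, Finset.sum_sub_distrib, h, ha, hb,
    Finset.sum_const, Finset.card_univ, Fintype.card_fin]
  rw [div_eq_inv_mul, div_eq_inv_mul, cotarget_scaled, ← one_sub_PZZ]
  rw [← Nat.cast_smul_eq_nsmul ℝ]
  push_cast
  rw [← inv_pow]
  generalize (Real.sin θ + Real.cos θ)⁻¹ = y
  module

/-- The optimal strategy is a convex combination of the identity and the projector on the target. -/
theorem optStrategy_eq {θ : ℝ} (hs : 0 < Real.sin θ) (hc : 0 < Real.cos θ) :
    optStrategy θ = qOpt θ • 1 + (1 - qOpt θ) • ketbra (target θ) := by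
  have hsc := Real.sin_sq_add_cos_sq θ
  -- The weight `α` is the one that gives `cotarget` the same eigenvalue as `|01⟩` and `|10⟩`.
  rw [optStrategy, sum_coTest hs hc, ← target_cotarget_sum, weight_eq, qOpt_eq]
  have hk : (Real.sin θ + Real.cos θ) ^ 2 = 1 + 2 * (Real.sin θ * Real.cos θ) := by
    linear_combination hsc
  rw [hk]
  have hp : 0 < Real.sin θ * Real.cos θ := mul_pos hs hc
  generalize Real.sin θ * Real.cos θ = x at hp
  match_scalars <;> field_simp <;> ring

theorem weight_pos {θ : ℝ} (hs : 0 < Real.sin θ) (hc : 0 < Real.cos θ) : 0 < weight θ := by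
  rw [weight_eq]
  have h := two_mul_le_add_sq (Real.sin θ) (Real.cos θ)
  rw [Real.sin_sq_add_cos_sq] at h
  exact div_pos (by linarith) (by positivity)

theorem weight_lt_one {θ : ℝ} (hs : 0 < Real.sin θ) (hc : 0 < Real.cos θ) : weight θ < 1 := by
  have hp : 0 < Real.sin θ * Real.cos θ := mul_pos hs hc
  rw [weight_eq, div_lt_one (by positivity)]
  linarith

theorem isStrategy_optStrategy {θ : ℝ} (hs : 0 < Real.sin θ) (hc : 0 < Real.cos θ) :
    IsStrategy θ (optStrategy θ) := by
  have h0 := weight_pos hs hc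
  have h1 := weight_lt_one hs hc
  have hco : ∀ k, coTest θ k ∈ convexHull ℝ {P : Op | IsLocalTest P} := fun k =>
    subset_convexHull ℝ _
      (isLocalTest_one_sub_ketbra (uVec_vVec_unit hs hc k).1 (uVec_vVec_unit hs hc k).2)
  constructor
  · have h := (convex_convexHull ℝ {P : Op | IsLocalTest P}).sum_mem (t := Finset.univ)
      (w := fun _ : Fin 3 => (1 / 3 : ℝ)) (fun _ _ => by norm_num) (by norm_num) fun k _ => hco k
    convert convex_convexHull ℝ _ (subset_convexHull ℝ {P : Op | IsLocalTest P} isLocalTest_PZZ) h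
      h0.le (sub_nonneg.2 h1.le) (by ring) using 1
    rw [optStrategy, ← Finset.smul_sum, smul_smul]
    ring_nf
  · rw [optStrategy_eq hs hc, expect_add, expect_smul, expect_smul, expect_target_one,
      expect_ketbra, target_dotProduct_self]
    simp

/-! ### Passing probabilities -/

theorem IsStrategy.posSemidef {θ : ℝ} (hs : 0 < Real.sin θ) (hc : 0 < Real.cos θ)
    (hne : Real.sin θ ≠ Real.cos θ) {Ω : Op} (hΩ : IsStrategy θ Ω) : Ω.PosSemidef :=
  (mem_convexHull_localTest hs hc hne hΩ.1).1

theorem IsStrategy.one_sub_posSemidef {θ : ℝ} (hs : 0 < Real.sin θ) (hc : 0 < Real.cos θ)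
    (hne : Real.sin θ ≠ Real.cos θ) {Ω : Op} (hΩ : IsStrategy θ Ω) : (1 - Ω).PosSemidef :=
  (mem_convexHull_localTest hs hc hne hΩ.1).2.1

theorem IsStrategy.qOpt_le {θ : ℝ} (hs : 0 < Real.sin θ) (hc : 0 < Real.cos θ)
    (hne : Real.sin θ ≠ Real.cos θ) {Ω : Op} (hΩ : IsStrategy θ Ω) :
    qOpt θ ≤ passProb Ω (orthWitness θ) :=
  (mem_convexHull_localTest hs hc hne hΩ.1).2.2 hΩ.2

theorem IsStrategy.mulVec_target {θ : ℝ} (hs : 0 < Real.sin θ) (hc : 0 < Real.cos θ)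
    (hne : Real.sin θ ≠ Real.cos θ) {Ω : Op} (hΩ : IsStrategy θ Ω) :
    Ω *ᵥ target θ = target θ := by
  have h := mulVec_eq_zero_of_expect_eq_zero (hΩ.one_sub_posSemidef hs hc hne) (φ := target θ)
    (by rw [expect_sub, expect_target_one, hΩ.2, sub_self])
  rw [Matrix.sub_mulVec, Matrix.one_mulVec, sub_eq_zero] at h
  exact h.symm

theorem passProb_optStrategy {θ : ℝ} (hs : 0 < Real.sin θ) (hc : 0 < Real.cos θ) {σ : Op}
    (hσ : IsState σ) :
    passProb (optStrategy θ) σ = qOpt θ + (1 - qOpt θ) * expect (target θ) σ := by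
  rw [optStrategy_eq hs hc, passProb_add_left, passProb_smul_left, passProb_smul_left,
    passProb_one hσ, passProb_ketbra_left, mul_one]

theorem expect_optStrategy {θ : ℝ} (hs : 0 < Real.sin θ) (hc : 0 < Real.cos θ) {φ : Vec}
    (hφ : star φ ⬝ᵥ φ = 1) (horth : star (target θ) ⬝ᵥ φ = 0) :
    expect φ (optStrategy θ) = qOpt θ := by
  rw [← passProb_ketbra_right, passProb_optStrategy hs hc (isState_ketbra hφ), expect_ketbra,
    ← star_star (star φ ⬝ᵥ target θ), ← Matrix.star_dotProduct, horth]
  simp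

theorem isGreatest_orthPass_optStrategy {θ : ℝ} (hs : 0 < Real.sin θ) (hc : 0 < Real.cos θ) :
    IsGreatest (orthPass θ (optStrategy θ)) (qOpt θ) := by
  constructor
  · exact ⟨cotarget θ, cotarget_dotProduct_self θ, target_dotProduct_cotarget θ,
      (expect_optStrategy hs hc (cotarget_dotProduct_self θ) (target_dotProduct_cotarget θ)).symm⟩
  · rintro _ ⟨φ, hφ, horth, rfl⟩
    exact (expect_optStrategy hs hc hφ horth).le

theorem expect_target_orthWitness (θ : ℝ) : expect (target θ) (orthWitness θ) = 0 := by
  have h : ∀ φ, star (target θ) ⬝ᵥ φ = 0 → expect φ (ketbra (target θ)) = 0 := fun φ hφ => by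
    rw [expect_ketbra, hφ, map_zero]
  rw [← passProb_ketbra_left, passProb_orthWitness, h _ (target_dotProduct_cotarget θ),
    h _ (target_dotProduct_tensor01 θ), h _ (target_dotProduct_tensor10 θ)]
  ring

theorem passProb_orthWitness_le {θ : ℝ} (hs : 0 < Real.sin θ) (hc : 0 < Real.cos θ) {M : Op}
    {x : ℝ} (hx : ∀ φ, star φ ⬝ᵥ φ = 1 → star (target θ) ⬝ᵥ φ = 0 → expect φ M ≤ x) :
    passProb M (orthWitness θ) ≤ x := by
  have h0 := qOpt_pos hs hc
  have h1 := qOpt_lt_one hs hc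
  have e1 := hx _ (cotarget_dotProduct_self θ) (target_dotProduct_cotarget θ)
  have e2 := hx _ tensor01_dotProduct_self (target_dotProduct_tensor01 θ)
  have e3 := hx _ tensor10_dotProduct_self (target_dotProduct_tensor10 θ)
  have f1 := mul_le_mul_of_nonneg_left e1 h0.le
  have f2 := mul_le_mul_of_nonneg_left (add_le_add e2 e3) (by linarith : 0 ≤ (1 - qOpt θ) / 2)
  rw [passProb_orthWitness]
  linarith

theorem qOpt_le_sSup_orthPass {θ : ℝ} (hs : 0 < Real.sin θ) (hc : 0 < Real.cos θ)
    (hne : Real.sin θ ≠ Real.cos θ) {Ω : Op} (hΩ : IsStrategy θ Ω) :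
    qOpt θ ≤ sSup (orthPass θ Ω) := by
  -- The witness averages unit vectors orthogonal to the target. The bound `1` is supplied because
  -- `le_csSup` needs boundedness.
  refine (hΩ.qOpt_le hs hc hne).trans
    (passProb_orthWitness_le hs hc fun φ hφ horth => le_csSup ⟨1, ?_⟩ ⟨φ, hφ, horth, rfl⟩)
  rintro _ ⟨φ, hφ, -, rfl⟩
  rw [← passProb_ketbra_right]
  exact passProb_le_one (hΩ.one_sub_posSemidef hs hc hne) (isState_ketbra hφ)

/-! ### Uniqueness -/

theorem expect_smul_vec (r : ℝ) (φ : Vec) (M : Op) :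
    expect ((r : ℂ) • φ) M = r ^ 2 * expect φ M := by
  rw [expect, Matrix.mulVec_smul, star_smul, smul_dotProduct, dotProduct_smul, smul_smul,
    RCLike.star_def, Complex.conj_ofReal, ← Complex.ofReal_mul, smul_eq_mul, Complex.re_ofReal_mul,
    expect, sq]

theorem expect_nonneg_of_unit {θ : ℝ} {M : Op}
    (hM : ∀ φ, star φ ⬝ᵥ φ = 1 → star (target θ) ⬝ᵥ φ = 0 → 0 ≤ expect φ M) (φ : Vec)
    (horth : star (target θ) ⬝ᵥ φ = 0) : 0 ≤ expect φ M := by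
  by_cases h0 : φ = 0
  · simp [h0, expect]
  have hnn : 0 < star φ ⬝ᵥ φ := Matrix.dotProduct_star_self_pos_iff.mpr h0
  obtain ⟨hre, him⟩ := Complex.pos_iff.mp hnn
  obtain ⟨n, hn⟩ : ∃ n : ℝ, star φ ⬝ᵥ φ = n := ⟨_, Complex.ext rfl him.symm⟩
  rw [hn, Complex.ofReal_re] at hre
  have hsqrt : √n ^ 2 = n := Real.sq_sqrt hre.le
  have hpos : 0 < √n := Real.sqrt_pos.mpr hre
  have h := hM ((((√n)⁻¹ : ℝ) : ℂ) • φ) ?_ ?_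
  · rw [expect_smul_vec] at h
    exact nonneg_of_mul_nonneg_right h (by positivity)
  · rw [star_smul, smul_dotProduct, dotProduct_smul, hn, RCLike.star_def, Complex.conj_ofReal,
      smul_eq_mul, smul_eq_mul, ← Complex.ofReal_mul, ← Complex.ofReal_mul, Complex.ofReal_eq_one]
    nth_rewrite 3 [← hsqrt]
    field_simp
  · rw [dotProduct_smul, horth, smul_zero]

/-- A Hermitian operator killing the target has no cross terms with the complement. -/
theorem posSemidef_of_orth {θ : ℝ} {M : Op} (hM : M.IsHermitian) (hψ : M *ᵥ target θ = 0)
    (horth : ∀ φ, star (target θ) ⬝ᵥ φ = 0 → 0 ≤ expect φ M) : M.PosSemidef := by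
  refine Matrix.PosSemidef.of_dotProduct_mulVec_nonneg hM fun φ => ?_
  rw [Complex.nonneg_iff]
  refine ⟨?_, (hM.im_star_dotProduct_mulVec_self φ).symm⟩
  obtain ⟨χ, z, hχ, rfl⟩ : ∃ (χ : Vec) (z : ℂ), star (target θ) ⬝ᵥ χ = 0 ∧ φ = χ + z • target θ := by
    refine ⟨φ - (star (target θ) ⬝ᵥ φ) • target θ, star (target θ) ⬝ᵥ φ, ?_, by simp⟩
    rw [dotProduct_sub, dotProduct_smul, target_dotProduct_self]
    simp
  have hψ' : star (target θ) ⬝ᵥ (M *ᵥ χ) = 0 := by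
    rw [Matrix.dotProduct_mulVec, ← hM.eq, ← Matrix.star_mulVec, hψ, star_zero, zero_dotProduct]
  rw [Matrix.mulVec_add, Matrix.mulVec_smul, hψ, smul_zero, add_zero, star_add, star_smul,
    add_dotProduct, smul_dotProduct, hψ', smul_zero, add_zero]
  exact horth χ hχ

theorem IsStrategy.eq_optStrategy {θ : ℝ} (hs : 0 < Real.sin θ) (hc : 0 < Real.cos θ)
    (hne : Real.sin θ ≠ Real.cos θ) {Ω : Op} (hΩ : IsStrategy θ Ω)
    (hle : ∀ φ, star φ ⬝ᵥ φ = 1 → star (target θ) ⬝ᵥ φ = 0 → expect φ Ω ≤ qOpt θ) :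
    Ω = optStrategy θ := by
  have hopt := isStrategy_optStrategy hs hc
  have h0 := qOpt_pos hs hc
  have h1 := qOpt_lt_one hs hc
  have hherm : (optStrategy θ - Ω).IsHermitian :=
    (hopt.posSemidef hs hc hne).1.sub (hΩ.posSemidef hs hc hne).1
  have hψ : (optStrategy θ - Ω) *ᵥ target θ = 0 := by
    rw [Matrix.sub_mulVec, hopt.mulVec_target hs hc hne, hΩ.mulVec_target hs hc hne, sub_self]
  have hpsd : (optStrategy θ - Ω).PosSemidef := by
    refine posSemidef_of_orth hherm hψ (expect_nonneg_of_unit fun φ hφ horth => ?_)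
    rw [expect_sub, expect_optStrategy hs hc hφ horth, sub_nonneg]
    exact hle φ hφ horth
  have hW : passProb (optStrategy θ - Ω) (orthWitness θ) ≤ 0 := by
    rw [passProb_sub_left, passProb_optStrategy hs hc (isState_orthWitness hs hc),
      expect_target_orthWitness, mul_zero, add_zero, sub_nonpos]
    exact hΩ.qOpt_le hs hc hne
  have hsum := expect_basis_sum θ (optStrategy θ - Ω)
  have e0 : expect (target θ) (optStrategy θ - Ω) = 0 := by
    rw [expect_sub, hopt.2, hΩ.2, sub_self]
  have e1 := expect_nonneg hpsd (cotarget θ)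
  have e2 := expect_nonneg hpsd (tensor ![1, 0] ![0, 1])
  have e3 := expect_nonneg hpsd (tensor ![0, 1] ![1, 0])
  rw [passProb_orthWitness] at hW
  -- The witness has strictly positive weight on each of the three basis vectors of the complement,
  -- so all three expectations vanish and the trace is zero.
  have f1 : expect (cotarget θ) (optStrategy θ - Ω) ≤ 0 := by
    nlinarith [mul_nonneg (by linarith : 0 ≤ (1 - qOpt θ) / 2) (add_nonneg e2 e3)]
  have f2 : expect (tensor ![1, 0] ![0, 1]) (optStrategy θ - Ω) +
      expect (tensor ![0, 1] ![1, 0]) (optStrategy θ - Ω) ≤ 0 := by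
    nlinarith [mul_nonneg h0.le e1]
  have htr : (optStrategy θ - Ω).trace = 0 := by
    refine Complex.ext ?_ (Complex.nonneg_iff.mp hpsd.trace_nonneg).2.symm
    rw [← hsum, Complex.zero_re]
    linarith
  exact (sub_eq_zero.mp (hpsd.trace_eq_zero_iff.mp htr)).symm

/-! ### States of bounded fidelity -/

theorem isBad_mixture {θ ε : ℝ} (h0 : 0 ≤ ε) (h1 : ε ≤ 1) {τ : Op} (hτ : IsState τ)
    (horth : expect (target θ) τ = 0) : IsBad θ ε ((1 - ε) • ketbra (target θ) + ε • τ) := by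
  refine ⟨(isState_ketbra (target_dotProduct_self θ)).convex hτ (by linarith) h0 (by ring), ?_⟩
  rw [expect_add, expect_smul, expect_smul, horth, expect_ketbra, target_dotProduct_self]
  simp

theorem IsStrategy.passProb_mixture {θ : ℝ} {Ω : Op} (hΩ : IsStrategy θ Ω) (ε : ℝ) (τ : Op) :
    passProb Ω ((1 - ε) • ketbra (target θ) + ε • τ) = 1 - ε + ε * passProb Ω τ := by
  rw [passProb_add_right, passProb_smul_right, passProb_smul_right, passProb_ketbra_right, hΩ.2,
    mul_one]

/-- The state is chosen before the strategy, so it serves copies measured with different strategies.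
-/
theorem exists_isBad_le_passProb {θ ε : ℝ} (hs : 0 < Real.sin θ) (hc : 0 < Real.cos θ)
    (hne : Real.sin θ ≠ Real.cos θ) (h0 : 0 ≤ ε) (h1 : ε ≤ 1) :
    ∃ σ, IsBad θ ε σ ∧ ∀ Ω, IsStrategy θ Ω → 1 - ε * (1 - qOpt θ) ≤ passProb Ω σ := by
  refine ⟨_, isBad_mixture h0 h1 (isState_orthWitness hs hc) (expect_target_orthWitness θ),
    fun Ω hΩ => ?_⟩
  rw [hΩ.passProb_mixture]
  linarith [mul_le_mul_of_nonneg_left (hΩ.qOpt_le hs hc hne) h0]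

theorem IsBad.passProb_optStrategy_le {θ ε : ℝ} (hs : 0 < Real.sin θ) (hc : 0 < Real.cos θ)
    {σ : Op} (hσ : IsBad θ ε σ) : passProb (optStrategy θ) σ ≤ 1 - ε * (1 - qOpt θ) := by
  rw [passProb_optStrategy hs hc hσ.1]
  linarith [mul_le_mul_of_nonneg_left hσ.2 (sub_nonneg.2 (qOpt_lt_one hs hc).le)]

theorem isGreatest_badPass_optStrategy {θ ε : ℝ} (hs : 0 < Real.sin θ) (hc : 0 < Real.cos θ)
    (hne : Real.sin θ ≠ Real.cos θ) (h0 : 0 ≤ ε) (h1 : ε ≤ 1) :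
    IsGreatest (badPass θ ε (optStrategy θ)) (1 - ε * (1 - qOpt θ)) := by
  obtain ⟨σ, hσ, h⟩ := exists_isBad_le_passProb hs hc hne h0 h1
  constructor
  · exact ⟨σ, hσ, (h _ (isStrategy_optStrategy hs hc)).antisymm
      (hσ.passProb_optStrategy_le hs hc)⟩
  · rintro _ ⟨τ, hτ, rfl⟩
    exact hτ.passProb_optStrategy_le hs hc

theorem IsStrategy.bddAbove_badPass {θ : ℝ} (ε : ℝ) (hs : 0 < Real.sin θ) (hc : 0 < Real.cos θ)
    (hne : Real.sin θ ≠ Real.cos θ) {Ω : Op} (hΩ : IsStrategy θ Ω) :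
    BddAbove (badPass θ ε Ω) := by
  refine ⟨1, ?_⟩
  rintro _ ⟨σ, hσ, rfl⟩
  exact passProb_le_one (hΩ.one_sub_posSemidef hs hc hne) hσ.1

theorem isOptimal_iff {θ ε : ℝ} (hs : 0 < Real.sin θ) (hc : 0 < Real.cos θ)
    (hne : Real.sin θ ≠ Real.cos θ) (h0 : 0 < ε) (h1 : ε ≤ 1) (Ω : Op) :
    IsOptimal θ ε Ω ↔ Ω = optStrategy θ := by
  have hopt := isStrategy_optStrategy hs hc
  have hsup := (isGreatest_badPass_optStrategy hs hc hne h0.le h1).csSup_eq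
  constructor
  · rintro ⟨hΩ, hmin⟩
    refine hΩ.eq_optStrategy hs hc hne fun φ hφ horth => ?_
    -- An orthogonal `φ` accepted with probability above `q` would make this mixture violate
    -- optimality; `ε > 0` allows cancellation.
    have hbad : IsBad θ ε ((1 - ε) • ketbra (target θ) + ε • ketbra φ) := by
      refine isBad_mixture h0.le h1 (isState_ketbra hφ) ?_
      rw [← passProb_ketbra_left, passProb_ketbra_right, expect_ketbra, horth, map_zero]
    have h := (le_csSup (hΩ.bddAbove_badPass ε hs hc hne) ⟨_, hbad, rfl⟩).trans (hmin _ hopt)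
    rw [hsup, hΩ.passProb_mixture, passProb_ketbra_right] at h
    exact le_of_mul_le_mul_left (by linarith) h0
  · rintro rfl
    refine ⟨hopt, fun Ω' hΩ' => ?_⟩
    obtain ⟨σ, hσ, h⟩ := exists_isBad_le_passProb hs hc hne h0.le h1
    rw [hsup]
    exact (h _ hΩ').trans (le_csSup (hΩ'.bddAbove_badPass ε hs hc hne) ⟨σ, hσ, rfl⟩)

/-! ### The number of measurements -/

theorem pow_le_iff_log_div_le {r δ : ℝ} (hr : 0 < r) (hr1 : r < 1) (hδ : 0 < δ) (n : ℕ) :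
    r ^ n ≤ δ ↔ Real.log δ⁻¹ / Real.log r⁻¹ ≤ n := by
  have hlog : 0 < Real.log r⁻¹ := Real.log_pos ((one_lt_inv₀ hr).mpr hr1)
  rw [div_le_iff₀ hlog, Real.log_inv, Real.log_inv, mul_neg, neg_le_neg_iff, ← Real.log_pow,
    Real.log_le_log_iff (pow_pos hr n) hδ]

theorem passRate_pos {θ ε : ℝ} (hs : 0 < Real.sin θ) (hc : 0 < Real.cos θ) (h1 : ε ≤ 1) :
    0 < 1 - ε * (1 - qOpt θ) := by
  have hq := qOpt_pos hs hc
  have h := mul_le_mul_of_nonneg_right h1 (sub_nonneg.2 (qOpt_lt_one hs hc).le)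
  linarith

theorem passRate_lt_one {θ ε : ℝ} (hs : 0 < Real.sin θ) (hc : 0 < Real.cos θ) (h0 : 0 < ε) :
    1 - ε * (1 - qOpt θ) < 1 :=
  sub_lt_self _ (mul_pos h0 (sub_pos.2 (qOpt_lt_one hs hc)))

theorem Verifies.pow_le {θ ε δ : ℝ} (hs : 0 < Real.sin θ) (hc : 0 < Real.cos θ)
    (hne : Real.sin θ ≠ Real.cos θ) (h0 : 0 < ε) (h1 : ε ≤ 1) {n : ℕ} {Ω : Fin n → Op}
    (hΩ : ∀ i, IsStrategy θ (Ω i)) (h : Verifies θ ε δ Ω) : (1 - ε * (1 - qOpt θ)) ^ n ≤ δ := by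
  obtain ⟨σ, hσ, hle⟩ := exists_isBad_le_passProb hs hc hne h0.le h1
  refine le_trans ?_ (h (fun _ => σ) fun _ => hσ)
  calc (1 - ε * (1 - qOpt θ)) ^ n = ∏ _i : Fin n, (1 - ε * (1 - qOpt θ)) := by simp
    _ ≤ _ := Finset.prod_le_prod (fun _ _ => (passRate_pos hs hc h1).le) fun i _ => hle _ (hΩ i)

theorem verifies_optStrategy_of_pow_le {θ ε δ : ℝ} (hs : 0 < Real.sin θ) (hc : 0 < Real.cos θ)
    (hne : Real.sin θ ≠ Real.cos θ) {n : ℕ} (h : (1 - ε * (1 - qOpt θ)) ^ n ≤ δ) :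
    Verifies θ ε δ (fun _ : Fin n => optStrategy θ) := by
  intro σ hσ
  refine le_trans ?_ h
  calc ∏ i, passProb (optStrategy θ) (σ i) ≤ ∏ _i : Fin n, (1 - ε * (1 - qOpt θ)) :=
        Finset.prod_le_prod
          (fun i _ => passProb_nonneg ((isStrategy_optStrategy hs hc).posSemidef hs hc hne)
            (hσ i).1.1)
          fun i _ => (hσ i).passProb_optStrategy_le hs hc
    _ = _ := by simp

theorem suffices_iff_verifies_optStrategy {θ ε δ : ℝ} (hs : 0 < Real.sin θ) (hc : 0 < Real.cos θ)
    (hne : Real.sin θ ≠ Real.cos θ) (h0 : 0 < ε) (h1 : ε ≤ 1) (n : ℕ) :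
    Suffices θ ε δ n ↔ Verifies θ ε δ (fun _ : Fin n => optStrategy θ) :=
  ⟨fun ⟨_, hΩ, h⟩ => verifies_optStrategy_of_pow_le hs hc hne (h.pow_le hs hc hne h0 h1 hΩ),
    fun h => ⟨_, fun _ => isStrategy_optStrategy hs hc, h⟩⟩

theorem suffices_iff_log_le {θ ε δ : ℝ} (hs : 0 < Real.sin θ) (hc : 0 < Real.cos θ)
    (hne : Real.sin θ ≠ Real.cos θ) (h0 : 0 < ε) (h1 : ε ≤ 1) (hδ : 0 < δ) (n : ℕ) :
    Suffices θ ε δ n ↔ Real.log δ⁻¹ / Real.log (1 - ε * (1 - qOpt θ))⁻¹ ≤ n := by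
  rw [← pow_le_iff_log_div_le (passRate_pos hs hc h1) (passRate_lt_one hs hc h0) hδ]
  exact ⟨fun ⟨_, hΩ, h⟩ => h.pow_le hs hc hne h0 h1 hΩ, fun h =>
    ⟨_, fun _ => isStrategy_optStrategy hs hc, verifies_optStrategy_of_pow_le hs hc hne h⟩⟩

theorem numMeas_eq_ceil {θ ε δ : ℝ} (hs : 0 < Real.sin θ) (hc : 0 < Real.cos θ)
    (hne : Real.sin θ ≠ Real.cos θ) (h0 : 0 < ε) (h1 : ε ≤ 1) (hδ : 0 < δ) :
    numMeas θ ε δ = ⌈Real.log δ⁻¹ / Real.log (1 - ε * (1 - qOpt θ))⁻¹⌉₊ := by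
  have h := suffices_iff_log_le hs hc hne h0 h1 hδ
  apply le_antisymm
  · exact Nat.sInf_le ((h _).mpr (Nat.le_ceil _))
  · exact le_csInf ⟨_, (h _).mpr (Nat.le_ceil _)⟩ fun n hn => Nat.ceil_le.mpr ((h n).mp hn)

open Filter in
theorem isEquivalent_log_div {p L : ℝ} (hp : 0 < p) (hL : L ≠ 0) :
    (fun ε : ℝ => L / Real.log (1 - ε * p)⁻¹) ~[𝓝[>] 0] fun ε : ℝ => p⁻¹ * ε⁻¹ * L := by
  apply Asymptotics.isEquivalent_of_tendsto_one
  -- The quotient of the two sides is `p` over the slope of this function at zero.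
  have hd : HasDerivAt (fun ε : ℝ => Real.log (1 - ε * p)⁻¹) p 0 := by
    have h1 : HasDerivAt (fun ε : ℝ => 1 - ε * p) (-p) 0 := by
      simpa using ((hasDerivAt_id (0 : ℝ)).mul_const p).const_sub 1
    have h2 := (h1.log (by simp)).fun_neg
    simp only [Real.log_inv]
    simpa using h2
  have ht := hd.tendsto_slope_zero_right.inv₀ hp.ne' |>.const_mul p
  rw [mul_inv_cancel₀ hp.ne'] at ht
  refine ht.congr' (eventually_nhdsWithin_of_forall fun ε hε => ?_)
  have hε' : ε ≠ 0 := (Set.mem_Ioi.mp hε).ne'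
  simp only [Pi.div_apply, zero_add, zero_mul, sub_zero, inv_one, Real.log_one, smul_eq_mul]
  rw [div_eq_mul_inv, div_eq_mul_inv, mul_inv, mul_inv, mul_inv, inv_inv, inv_inv]
  field_simp

open Filter in
theorem isEquivalent_numMeas {θ δ : ℝ} (hs : 0 < Real.sin θ) (hc : 0 < Real.cos θ)
    (hne : Real.sin θ ≠ Real.cos θ) (hδ : 0 < δ) (hδ1 : δ < 1) :
    (fun ε : ℝ => (numMeas θ ε δ : ℝ)) ~[𝓝[>] 0]
      fun ε : ℝ => (2 + Real.sin θ * Real.cos θ) * ε⁻¹ * Real.log δ⁻¹ := by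
  have hp := sub_pos.2 (qOpt_lt_one hs hc)
  have hL : 0 < Real.log δ⁻¹ := Real.log_pos ((one_lt_inv₀ hδ).mpr hδ1)
  have hequiv := isEquivalent_log_div hp hL.ne'
  rw [one_sub_qOpt hs hc, inv_inv, ← one_sub_qOpt hs hc] at hequiv
  have htop : Tendsto (fun ε : ℝ => (2 + Real.sin θ * Real.cos θ) * ε⁻¹ * Real.log δ⁻¹)
      (𝓝[>] 0) atTop :=
    (tendsto_inv_nhdsGT_zero.const_mul_atTop (by positivity)).atTop_mul_const hL
  -- Rounding up is negligible because the argument tends to infinity.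
  have hceil := Asymptotics.isEquivalent_nat_ceil.comp_tendsto (hequiv.symm.tendsto_atTop htop)
  refine (hceil.trans hequiv).congr_left ?_
  filter_upwards [Ioc_mem_nhdsGT (zero_lt_one' ℝ)] with ε hε
  simp only [Function.comp_apply]
  rw [numMeas_eq_ceil hs hc hne hε.1 hε.2 hδ]

end TwoQubit


open TwoQubit in
theorem theorem1 (θ : ℝ) (hθ₀ : 0 < θ) (hθ₁ : θ < Real.pi / 2) (hθ₂ : θ ≠ Real.pi / 4) :
    -- the four measurement settings are local projective measurements, with positive weights
    (0 < weight θ ∧ weight θ < 1 ∧ IsLocalTest PZZ ∧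
      ∀ k, star (uVec θ k) ⬝ᵥ uVec θ k = 1 ∧ star (vVec θ k) ⬝ᵥ vVec θ k = 1 ∧
        IsLocalTest (coTest θ k)) ∧
    -- the maximal probability of accepting an orthogonal state, for `Ω_opt` and in general
    IsStrategy θ (optStrategy θ) ∧
    IsGreatest (orthPass θ (optStrategy θ)) (qOpt θ) ∧
    (∀ Ω, IsStrategy θ Ω → qOpt θ ≤ sSup (orthPass θ Ω)) ∧
    -- at every infidelity, `Ω_opt` is optimal, and any optimal strategy is `Ω_opt`
    (∀ ε : ℝ, 0 < ε → ε ≤ 1 →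
      IsGreatest (badPass θ ε (optStrategy θ)) (1 - ε * (1 - qOpt θ)) ∧
      ∀ Ω, IsOptimal θ ε Ω ↔ Ω = optStrategy θ) ∧
    -- the number of measurements
    (∀ ε δ : ℝ, 0 < ε → ε ≤ 1 → 0 < δ → δ < 1 → ∀ n : ℕ,
      (Suffices θ ε δ n ↔ Real.log δ⁻¹ / Real.log (1 - ε * (1 - qOpt θ))⁻¹ ≤ n) ∧
      (Suffices θ ε δ n ↔ Verifies θ ε δ (fun _ : Fin n => optStrategy θ))) ∧
    (∀ δ : ℝ, 0 < δ → δ < 1 →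
      (fun ε : ℝ => (numMeas θ ε δ : ℝ)) ~[𝓝[>] 0]
        fun ε : ℝ => (2 + Real.sin θ * Real.cos θ) * ε⁻¹ * Real.log δ⁻¹) := by
  have hs : 0 < Real.sin θ := Real.sin_pos_of_pos_of_lt_pi hθ₀ (by linarith [Real.pi_pos])
  have hc : 0 < Real.cos θ := Real.cos_pos_of_mem_Ioo ⟨by linarith, hθ₁⟩
  have hne : Real.sin θ ≠ Real.cos θ := by
    intro h
    rw [← Real.cos_pi_div_two_sub] at h
    have := Real.injOn_cos ⟨by linarith, by linarith⟩ ⟨hθ₀.le, by linarith⟩ h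
    exact hθ₂ (by linarith)
  have huv := uVec_vVec_unit hs hc
  exact ⟨⟨weight_pos hs hc, weight_lt_one hs hc, isLocalTest_PZZ,
      fun k => ⟨(huv k).1, (huv k).2, isLocalTest_one_sub_ketbra (huv k).1 (huv k).2⟩⟩,
    isStrategy_optStrategy hs hc, isGreatest_orthPass_optStrategy hs hc,
    fun _ hΩ => qOpt_le_sSup_orthPass hs hc hne hΩ,
    fun _ h0 h1 => ⟨isGreatest_badPass_optStrategy hs hc hne h0.le h1,
      isOptimal_iff hs hc hne h0 h1⟩,
    fun _ _ h0 h1 hδ _ n => ⟨suffices_iff_log_le hs hc hne h0 h1 hδ n,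
      suffices_iff_verifies_optStrategy hs hc hne h0 h1 n⟩,
    fun _ hδ hδ1 => isEquivalent_numMeas hs hc hne hδ hδ1⟩
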